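/- **Conventions.** A metric graph $\Gamma$ has a set $V$ of vertices and a set $E$ of edges (loops and multiple edges allowed), each edge $e$ being identified with a segment $[0,l_e]$, $0<l_e<\infty$; every vertex $v$ has finite degree $d_v$ (the number of edge ends at $v$). Put $L^2(\Gamma)=\bigoplus_e L^2(0,l_e)$. For a function that is in $H^2$ on each edge, its boundary data at $v$ are its values and its outgoing derivatives (derivatives in the direction from $v$ into the edge) along the $d_v$ edge ends at $v$. A self-adjoint vertex condition at $v$ requires the boundary data $(F,F')\in\mathbb C^{d_v}\times\mathbb C^{d_v}$ to lie in a prescribed subspace that is Lagrangian for the form $\sum_d (F'_d\overline{G_d}-F_d\overline{G'_d})$. The Neumann condition at $v$ says that the function is continuous at $v$ and that the sum of its outgoing derivatives at $v$ is $0$; the Dirichlet condition at $v$ says that all values at $v$ are $0$. The Hamiltonian with given vertex conditions is the operator $u\mapsto -u''$ in $L^2(\Gamma)$ whose domain consists of the $u\in L^2(\Gamma)$ that are in $H^2$ on each edge, have $u''\in L^2(\Gamma)$, and satisfy the conditions at all vertices. **Data.** Let $\Gamma_0$ be a connected metric graph, finite or infinite, with $l_0\le l_e\le L$ for all edges $e$,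 for some constants $0<l_0\le L<\infty$, and with $\sup_v d_v<\infty$ (the last two assumptions are automatic if $\Gamma_0$ is finite). Let $\Gamma_1$ be a finite connected metric graph with a root vertex $v_1$ and with arbitrary self-adjoint vertex conditions prescribed at the vertices other than $v_1$. Let $\Gamma$ be obtained by attaching to each vertex $v$ of $\Gamma_0$ its own copy of $\Gamma_1$, the root $v_1$ of the copy being identified with $v$. Let $H$ be the Hamiltonian on $\Gamma$ with Neumann conditions at the vertices of $\Gamma_0$ (involving all edges of $\Gamma$ at $v$, both those of $\Gamma_0$ and those of the attached copy) and the prescribed conditions at the other vertices of each copy of $\Gamma_1$. Let $H_1$ be the Hamiltonian on $\Gamma_1$ with the prescribed conditions at the vertices other than $v_1$ and the Dirichlet condition at $v_1$. Let $$\sigma_D=\overline{\Big\{\tfrac{\pi^2n^2}{l_e^2} : e \text{ an edge of } \Gamma_0,\ n\in\mathbb Z\setminus\{0\}\Big\}}\subset\mathbb R .$$ **Theorem.** Let $\lambda_0\in\mathbb R\setminus\sigma_D$ be a simple eigenvalue of $H_1$ with an eigenfunction $\psi$ such that the sum of the outgoing derivatives of $\psi$ at $v_1$ is not zero. Then a punctured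 neighborhood of $\lambda_0$ does not meet the spectrum of $H$: there is $\varepsilon>0$ such that every $z\in\mathbb C$ (in particular every real $z$) with $0<|z-\lambda_0|<\varepsilon$ is in the resolvent set of $H$. -/

import Mathlib

open MeasureTheory Set Filter Topology
open scoped ComplexConjugate

noncomputable section

/-! ### Spectrum of an unbounded operator -/

namespace UnboundedOp

variable {X : Type*} [NormedAddCommGroup X] [NormedSpace ℂ X]

/-- The resolvent set of an unbounded operator `T`: the complex numbers `z` for which
`T - z : dom T → X` has a bounded everywhere defined two-sided inverse `R`. -/
def resolventSet (T : X →ₗ.[ℂ] X) : Set ℂ :=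
  {z | ∃ R : X →L[ℂ] X,
    (∀ f : X, ∃ h : R f ∈ T.domain, T ⟨R f, h⟩ - z • R f = f) ∧
    (∀ u : T.domain, R (T u - z • (u : X)) = u)}

/-- The spectrum of an unbounded operator. -/
def spectrum (T : X →ₗ.[ℂ] X) : Set ℂ := (resolventSet T)ᶜ

/-- The eigenspace `{u ∈ dom T | T u = z u}`. -/
def eigenspace (T : X →ₗ.[ℂ] X) (z : ℂ) : Submodule ℂ X where
  carrier := {u | ∃ h : u ∈ T.domain, T ⟨u, h⟩ = z • u}
  zero_mem' := ⟨T.domain.zero_mem, by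
    have : (⟨0, T.domain.zero_mem⟩ : T.domain) = 0 := rfl
    rw [this, T.map_zero, smul_zero]⟩
  add_mem' := by
    rintro a b ⟨ha, ea⟩ ⟨hb, eb⟩
    refine ⟨T.domain.add_mem ha hb, ?_⟩
    have : (⟨a + b, T.domain.add_mem ha hb⟩ : T.domain) = ⟨a, ha⟩ + ⟨b, hb⟩ := rfl
    rw [this, T.map_add, ea, eb, smul_add]
  smul_mem' := by
    rintro c a ⟨ha, ea⟩
    refine ⟨T.domain.smul_mem c ha, ?_⟩
    have : (⟨c • a, T.domain.smul_mem c ha⟩ : T.domain) = c • ⟨a, ha⟩ := rfl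
    rw [this, T.map_smul, ea, smul_comm]

/-- `z` is a simple eigenvalue: its eigenspace is one-dimensional. -/
def IsSimpleEigenvalue (T : X →ₗ.[ℂ] X) (z : ℂ) : Prop :=
  Module.finrank ℂ (eigenspace T z) = 1

end UnboundedOp

/-! ### Metric graphs -/

/-- A metric graph with vertex set `V` and edge set `E`; loops and multiple edges are allowed.
The edge `e` is identified with the segment `[0, len e]`. It has two ends, `(e, false)` (the point
`0`) and `(e, true)` (the point `len e`), and `endpt` is the vertex at an end. Every vertex has
finite degree. -/
structure MetricGraph (V E : Type*) where
  len : E → ℝ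
  len_pos : ∀ e, 0 < len e
  endpt : E × Bool → V
  finite_ends : ∀ v, {d : E × Bool | endpt d = v}.Finite

namespace MetricGraph

variable {V E V₀ E₀ V₁ E₁ : Type*}

/-- The edge ends at the vertex `v` (a loop at `v` contributes both of its ends). -/
abbrev Ends (Γ : MetricGraph V E) (v : V) : Type _ := {d : E × Bool // Γ.endpt d = v}

instance (Γ : MetricGraph V E) (v : V) : Finite (Γ.Ends v) := (Γ.finite_ends v).to_subtype

instance (Γ : MetricGraph V E) (v : V) : Fintype (Γ.Ends v) := Fintype.ofFinite _

/-- The degree of a vertex. -/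
def degree (Γ : MetricGraph V E) (v : V) : ℕ := Fintype.card (Γ.Ends v)

/-- Two vertices are joined by an edge. -/
def Adj (Γ : MetricGraph V E) (v w : V) : Prop :=
  ∃ (e : E) (b : Bool), Γ.endpt (e, b) = v ∧ Γ.endpt (e, !b) = w

/-- The graph is nonempty and any two vertices are joined by a path. -/
def IsConnected (Γ : MetricGraph V E) : Prop :=
  Nonempty V ∧ ∀ v w, Relation.ReflTransGen Γ.Adj v w

/-- The edge lengths are bounded below and above by finite positive constants. -/
def ConditionA (Γ : MetricGraph V E) : Prop :=
  ∃ l₀ L : ℝ, 0 < l₀ ∧ ∀ e, l₀ ≤ Γ.len e ∧ Γ.len e ≤ L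

/-- The Dirichlet spectrum of the graph: the closure of the set of the Dirichlet eigenvalues
of its edges. -/
def dirichletSpectrum (Γ : MetricGraph V E) : Set ℝ :=
  closure {x | ∃ (e : E) (n : ℤ), n ≠ 0 ∧ x = Real.pi ^ 2 * (n : ℝ) ^ 2 / Γ.len e ^ 2}

/-- Lebesgue measure on the edge `e`. -/
abbrev edgeMeasure (Γ : MetricGraph V E) (e : E) : Measure ℝ := volume.restrict (Ioc 0 (Γ.len e))

/-- The Hilbert space `L²(Γ) = ⨁ₑ L²(e)`. -/
abbrev L2 (Γ : MetricGraph V E) : Type _ := lp (fun e : E => Lp ℂ 2 (Γ.edgeMeasure e)) 2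

/-- `u` belongs to the Sobolev space `H²(e)` on each edge `e`, its second derivative along the
edges is `w`, its value at the edge end `d` is `F d`, and its derivative at the edge end `d`,
in the direction out of the vertex into the edge, is `F' d`.
Here `H²` of an interval is the space of the functions that have a representative `φ` that is
absolutely continuous together with its derivative `dφ`, with second derivative in `L²`. -/
def IsH2 (Γ : MetricGraph V E) (u w : Γ.L2) (F F' : E × Bool → ℂ) : Prop :=
  ∃ φ dφ : E → ℝ → ℂ, ∀ e,
    (u e : ℝ → ℂ) =ᵐ[Γ.edgeMeasure e] φ e ∧
    (∀ x ∈ Icc 0 (Γ.len e), φ e x = φ e 0 + ∫ t in (0 : ℝ)..x, dφ e t) ∧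
    (∀ x ∈ Icc 0 (Γ.len e), dφ e x = dφ e 0 + ∫ t in (0 : ℝ)..x, (w e : ℝ → ℂ) t) ∧
    F (e, false) = φ e 0 ∧ F (e, true) = φ e (Γ.len e) ∧
    F' (e, false) = dφ e 0 ∧ F' (e, true) = - dφ e (Γ.len e)

/-! #### Basic facts that make the operators below well defined -/

theorem integrable_edge (Γ : MetricGraph V E) (w : Γ.L2) (e : E) :
    IntervalIntegrable (w e : ℝ → ℂ) volume 0 (Γ.len e) := by
  rw [intervalIntegrable_iff_integrableOn_Ioc_of_le (Γ.len_pos e).le]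
  exact (Lp.memLp (w e)).integrable (by norm_num)

theorem integrable_deriv {l : ℝ} (hl : 0 < l) {w dφ : ℝ → ℂ} (hw : IntervalIntegrable w volume 0 l)
    (h : ∀ x ∈ Icc 0 l, dφ x = dφ 0 + ∫ t in (0 : ℝ)..x, w t) :
    IntervalIntegrable dφ volume 0 l := by
  have hc : ContinuousOn dφ (Icc 0 l) := by
    have := intervalIntegral.continuousOn_primitive_interval' hw (left_mem_uIcc)
    rw [uIcc_of_le hl.le] at this
    exact (continuousOn_const.add this).congr h
  exact ContinuousOn.intervalIntegrable (by rwa [uIcc_of_le hl.le])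

/-- A primitive that vanishes almost everywhere vanishes, and so does the function. -/
theorem primitive_eq_zero {l : ℝ} (hl : 0 < l) {g h : ℝ → ℂ} (hg : IntervalIntegrable g volume 0 l)
    (hh : ∀ x ∈ Icc 0 l, h x = h 0 + ∫ t in (0 : ℝ)..x, g t)
    (h0 : h =ᵐ[volume.restrict (Ioc 0 l)] 0) :
    (∀ x ∈ Icc 0 l, h x = 0) ∧ g =ᵐ[volume.restrict (Ioc 0 l)] 0 := by
  have hc : ContinuousOn h (Icc 0 l) := by
    have := intervalIntegral.continuousOn_primitive_interval' hg (left_mem_uIcc)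
    rw [uIcc_of_le hl.le] at this
    exact (continuousOn_const.add this).congr hh
  have hz : EqOn h 0 (Icc 0 l) := by
    refine Measure.eqOn_Icc_of_ae_eq volume hl.ne ?_ hc continuousOn_const
    rwa [restrict_Ioc_eq_restrict_Icc] at h0
  refine ⟨fun x hx => hz hx, ?_⟩
  have hd := hg.ae_hasDerivAt_integral
  rw [Filter.EventuallyEq, ae_restrict_iff' measurableSet_Ioc]
  have hne : ∀ᵐ x : ℝ ∂volume, x ≠ l := by simp [ae_iff, measure_singleton]
  filter_upwards [hd, hne] with x hx hxl hx'
  have hder := hx (by rw [uIcc_of_le hl.le]; exact Ioc_subset_Icc_self hx') 0 left_mem_uIcc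
  have hnhds : (fun y => ∫ t in (0 : ℝ)..y, g t) =ᶠ[𝓝 x] fun _ => (0 : ℂ) := by
    filter_upwards [Ioo_mem_nhds hx'.1 (lt_of_le_of_ne hx'.2 hxl)] with y hy
    have h1 := hh y ⟨hy.1.le, hy.2.le⟩
    rw [hz ⟨hy.1.le, hy.2.le⟩, hz (left_mem_Icc.2 hl.le)] at h1
    simpa using h1.symm
  exact (hder.congr_of_eventuallyEq hnhds.symm).unique (hasDerivAt_const x (0 : ℂ))

variable {Γ : MetricGraph V E}

theorem IsH2.zero : Γ.IsH2 0 0 0 0 := by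
  refine ⟨0, 0, fun e => ?_⟩
  have h0 := Lp.coeFn_zero ℂ 2 (Γ.edgeMeasure e)
  refine ⟨h0, fun x _ => by simp, fun x hx => ?_, rfl, rfl, rfl, by simp⟩
  rw [intervalIntegral.integral_zero_ae]
  · simp
  · rw [uIoc_of_le hx.1]
    rw [Filter.EventuallyEq, ae_restrict_iff' measurableSet_Ioc] at h0
    filter_upwards [h0] with t ht hm using ht ⟨hm.1, hm.2.trans hx.2⟩

theorem IsH2.add {u w u' w' : Γ.L2} {F F' G G' : E × Bool → ℂ} (h : Γ.IsH2 u w F F')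
    (h' : Γ.IsH2 u' w' G G') : Γ.IsH2 (u + u') (w + w') (F + G) (F' + G') := by
  obtain ⟨φ, dφ, h⟩ := h
  obtain ⟨χ, dχ, h'⟩ := h'
  refine ⟨φ + χ, dφ + dχ, fun e => ?_⟩
  obtain ⟨a1, a2, a3, a4, a5, a6, a7⟩ := h e
  obtain ⟨b1, b2, b3, b4, b5, b6, b7⟩ := h' e
  have sub : ∀ x ∈ Icc 0 (Γ.len e), uIcc 0 x ⊆ uIcc 0 (Γ.len e) := fun x hx => by
    rw [uIcc_of_le hx.1, uIcc_of_le (Γ.len_pos e).le]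
    exact Icc_subset_Icc_right hx.2
  have iw := Γ.integrable_edge w e
  have iw' := Γ.integrable_edge w' e
  have i1 := integrable_deriv (Γ.len_pos e) iw a3
  have i2 := integrable_deriv (Γ.len_pos e) iw' b3
  refine ⟨?_, fun x hx => ?_, fun x hx => ?_, ?_, ?_, ?_, ?_⟩
  · filter_upwards [Lp.coeFn_add (u e) (u' e), a1, b1] with x hx h1 h2
    simp only [lp.coeFn_add, Pi.add_apply] at hx ⊢
    rw [hx, h1, h2]
  · simp only [Pi.add_apply]
    rw [intervalIntegral.integral_add (i1.mono_set (sub x hx)) (i2.mono_set (sub x hx)),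
      a2 x hx, b2 x hx]
    ring
  · have : ∫ t in (0 : ℝ)..x, ((w + w') e : ℝ → ℂ) t =
        ∫ t in (0 : ℝ)..x, ((w e : ℝ → ℂ) t + (w' e : ℝ → ℂ) t) := by
      have hw := Lp.coeFn_add (w e) (w' e)
      rw [Filter.EventuallyEq, ae_restrict_iff' measurableSet_Ioc] at hw
      apply intervalIntegral.integral_congr_ae
      rw [uIoc_of_le hx.1]
      filter_upwards [hw] with t ht hm using ht ⟨hm.1, hm.2.trans hx.2⟩
    rw [this, intervalIntegral.integral_add (iw.mono_set (sub x hx)) (iw'.mono_set (sub x hx))]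
    simp only [Pi.add_apply]
    rw [a3 x hx, b3 x hx]
    ring
  · simp [a4, b4]
  · simp [a5, b5]
  · simp [a6, b6]
  · simp [a7, b7]; ring

theorem IsH2.smul {u w : Γ.L2} {F F' : E × Bool → ℂ} (c : ℂ) (h : Γ.IsH2 u w F F') :
    Γ.IsH2 (c • u) (c • w) (c • F) (c • F') := by
  obtain ⟨φ, dφ, h⟩ := h
  refine ⟨c • φ, c • dφ, fun e => ?_⟩
  obtain ⟨a1, a2, a3, a4, a5, a6, a7⟩ := h e
  refine ⟨?_, fun x hx => ?_, fun x hx => ?_, ?_, ?_, ?_, ?_⟩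
  · filter_upwards [Lp.coeFn_smul c (u e), a1] with x hx h1
    simp only [lp.coeFn_smul, Pi.smul_apply] at hx ⊢
    rw [hx, h1]
  · simp only [Pi.smul_apply]
    rw [intervalIntegral.integral_smul, a2 x hx, smul_add]
  · have : ∫ t in (0 : ℝ)..x, ((c • w) e : ℝ → ℂ) t =
        ∫ t in (0 : ℝ)..x, c • (w e : ℝ → ℂ) t := by
      have hw := Lp.coeFn_smul c (w e)
      rw [Filter.EventuallyEq, ae_restrict_iff' measurableSet_Ioc] at hw
      apply intervalIntegral.integral_congr_ae
      rw [uIoc_of_le hx.1]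
      filter_upwards [hw] with t ht hm using ht ⟨hm.1, hm.2.trans hx.2⟩
    rw [this, intervalIntegral.integral_smul]
    simp only [Pi.smul_apply]
    rw [a3 x hx, smul_add]
  · simp [a4]
  · simp [a5]
  · simp [a6]
  · simp [a7]

/-- The second derivative and the boundary values are determined by the function. -/
theorem IsH2.eq_zero {w : Γ.L2} {F F' : E × Bool → ℂ} (h : Γ.IsH2 0 w F F') :
    w = 0 ∧ F = 0 ∧ F' = 0 := by
  obtain ⟨φ, dφ, h⟩ := h
  have key : ∀ e, (∀ x ∈ Icc 0 (Γ.len e), φ e x = 0) ∧ (∀ x ∈ Icc 0 (Γ.len e), dφ e x = 0) ∧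
      (w e : ℝ → ℂ) =ᵐ[Γ.edgeMeasure e] 0 := by
    intro e
    obtain ⟨a1, a2, a3, -⟩ := h e
    have iw := Γ.integrable_edge w e
    obtain ⟨k1, k2⟩ := primitive_eq_zero (Γ.len_pos e) (integrable_deriv (Γ.len_pos e) iw a3) a2
      (a1.symm.trans (Lp.coeFn_zero ℂ 2 (Γ.edgeMeasure e)))
    obtain ⟨k3, k4⟩ := primitive_eq_zero (Γ.len_pos e) iw a3 k2
    exact ⟨k1, k3, k4⟩
  refine ⟨?_, ?_, ?_⟩
  · ext1
    funext e
    exact Lp.ext ((key e).2.2.trans (Lp.coeFn_zero ℂ 2 (Γ.edgeMeasure e)).symm)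
  · funext ⟨e, b⟩
    obtain ⟨-, -, -, a4, a5, -, -⟩ := h e
    cases b
    · simpa [a4] using (key e).1 0 (left_mem_Icc.2 (Γ.len_pos e).le)
    · simpa [a5] using (key e).1 _ (right_mem_Icc.2 (Γ.len_pos e).le)
  · funext ⟨e, b⟩
    obtain ⟨-, -, -, -, -, a6, a7⟩ := h e
    cases b
    · simpa [a6] using (key e).2.1 0 (left_mem_Icc.2 (Γ.len_pos e).le)
    · simpa [a7] using (key e).2.1 _ (right_mem_Icc.2 (Γ.len_pos e).le)

/-! ### Vertex conditions and Hamiltonians -/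

/-- A (linear, homogeneous) vertex condition at `v`: a subspace of the space of the pairs
(values, outgoing derivatives) along the edge ends at `v`. -/
abbrev VertexCondition (Γ : MetricGraph V E) (v : V) : Type _ :=
  Submodule ℂ ((Γ.Ends v → ℂ) × (Γ.Ends v → ℂ))

/-- A vertex condition is self-adjoint if it is Lagrangian, that is, equal to its orthogonal
complement with respect to the boundary form of `-d²/dx²`. -/
def VertexCondition.IsSelfAdjoint {v : V} (L : Γ.VertexCondition v) : Prop :=
  ∀ p, p ∈ L ↔ ∀ q ∈ L, ∑ d, (p.2 d * conj (q.1 d) - p.1 d * conj (q.2 d)) = 0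

/-- The Neumann (Kirchhoff) condition: continuity, and the outgoing derivatives sum to zero. -/
def neumann (Γ : MetricGraph V E) (v : V) : Γ.VertexCondition v where
  carrier := {p | (∀ d d', p.1 d = p.1 d') ∧ ∑ d, p.2 d = 0}
  zero_mem' := by simp
  add_mem' := by
    rintro p q ⟨hp, hp'⟩ ⟨hq, hq'⟩
    refine ⟨fun d d' => ?_, ?_⟩
    · simp [hp d d', hq d d']
    · simp [Finset.sum_add_distrib, hp', hq']
  smul_mem' := by
    rintro c p ⟨hp, hp'⟩
    refine ⟨fun d d' => ?_, ?_⟩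
    · simp [hp d d']
    · simp [← Finset.mul_sum, hp']

/-- The Dirichlet condition: the function vanishes at the vertex, along every edge. -/
def dirichlet (Γ : MetricGraph V E) (v : V) : Γ.VertexCondition v where
  carrier := {p | p.1 = 0}
  zero_mem' := rfl
  add_mem' := by
    intro p q hp hq
    simp only [mem_ofPred_eq] at hp hq
    simp [hp, hq]
  smul_mem' := by
    intro c p hp
    simp only [mem_ofPred_eq] at hp
    simp [hp]

/-- The graph of the operator `-d²/dx²` with the vertex conditions `L`: the pairs `(u, -u'')`
such that `u ∈ L²` is in `H²` on each edge, `u'' ∈ L²`, and `u` satisfies `L v` at each `v`. -/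
def hamiltonianGraph (Γ : MetricGraph V E) (L : ∀ v, Γ.VertexCondition v) :
    Submodule ℂ (Γ.L2 × Γ.L2) where
  carrier := {p | ∃ F F' : E × Bool → ℂ, Γ.IsH2 p.1 (-p.2) F F' ∧
    ∀ v, ((fun d : Γ.Ends v => F d), (fun d : Γ.Ends v => F' d)) ∈ L v}
  zero_mem' := ⟨0, 0, by simpa using IsH2.zero, fun v => (L v).zero_mem⟩
  add_mem' := by
    rintro p q ⟨F, F', h, hL⟩ ⟨G, G', k, kL⟩
    refine ⟨F + G, F' + G', ?_, fun v => (L v).add_mem (hL v) (kL v)⟩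
    have := h.add k
    rwa [← neg_add] at this
  smul_mem' := by
    rintro c p ⟨F, F', h, hL⟩
    refine ⟨c • F, c • F', ?_, fun v => (L v).smul_mem c (hL v)⟩
    have := h.smul c
    rwa [smul_neg] at this

/-- The Hamiltonian `-d²/dx²` in `L²(Γ)` with the vertex conditions `L`. -/
def hamiltonian (Γ : MetricGraph V E) (L : ∀ v, Γ.VertexCondition v) : Γ.L2 →ₗ.[ℂ] Γ.L2 :=
  (Γ.hamiltonianGraph L).toLinearPMap

/-- The graph of the Hamiltonian is the intended one. -/
theorem graph_hamiltonian (Γ : MetricGraph V E) (L : ∀ v, Γ.VertexCondition v) :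
    (Γ.hamiltonian L).graph = Γ.hamiltonianGraph L := by
  refine Submodule.toLinearPMap_graph_eq _ ?_
  rintro ⟨u, f⟩ ⟨F, F', h, -⟩ h0
  simp only at h0 h ⊢
  rw [h0] at h
  exact neg_eq_zero.1 h.eq_zero.1

/-! ### Decoration -/

/-- The graph obtained from `Γ₀` by attaching a copy of `Γ₁` to each vertex `v` of `Γ₀` and
identifying the root `v₁` of the copy with `v`. The vertex `(v, a)` is the vertex `a` of the copy
at `v`; the vertex `v` of `Γ₀` is the vertex `(v, v₁)`. The edges are those of `Γ₀` and, for each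
vertex `v` of `Γ₀`, a copy of those of `Γ₁`. -/
def decorate (Γ₀ : MetricGraph V₀ E₀) (Γ₁ : MetricGraph V₁ E₁) (v₁ : V₁) :
    MetricGraph (V₀ × V₁) (E₀ ⊕ V₀ × E₁) where
  len := Sum.elim Γ₀.len fun p => Γ₁.len p.2
  len_pos := by
    rintro (e | p)
    · exact Γ₀.len_pos e
    · exact Γ₁.len_pos p.2
  endpt := fun d => match d with
    | (Sum.inl e, b) => (Γ₀.endpt (e, b), v₁)
    | (Sum.inr (v, e), b) => (v, Γ₁.endpt (e, b))
  finite_ends := by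
    rintro ⟨v, a⟩
    refine (((Γ₀.finite_ends v).image fun d => (Sum.inl d.1, d.2)).union
      ((Γ₁.finite_ends a).image fun d => (Sum.inr (v, d.1), d.2))).subset ?_
    rintro ⟨e | ⟨v', e⟩, b⟩ h
    · left
      exact ⟨(e, b), (Prod.mk.inj h).1, rfl⟩
    · right
      obtain ⟨h1, h2⟩ := Prod.mk.inj h
      subst h1
      exact ⟨(e, b), h2, rfl⟩

/-- The inclusion of the edge ends at `a` in `Γ₁` into the edge ends at `(v, a)` in the decorated
graph (a bijection if `a ≠ v₁`). -/
def copyEnd (Γ₀ : MetricGraph V₀ E₀) (Γ₁ : MetricGraph V₁ E₁) (v₁ : V₁) (v : V₀) (a : V₁)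
    (d : Γ₁.Ends a) : (Γ₀.decorate Γ₁ v₁).Ends (v, a) :=
  ⟨(Sum.inr (v, d.1.1), d.1.2), Prod.ext rfl d.2⟩

open Classical in
/-- The vertex conditions of `H₁`: Dirichlet at `v₁`, and `L` at the other vertices of `Γ₁`. -/
def decorationConditions (Γ₁ : MetricGraph V₁ E₁) (v₁ : V₁) (L : ∀ a, Γ₁.VertexCondition a)
    (a : V₁) : Γ₁.VertexCondition a :=
  if a = v₁ then Γ₁.dirichlet a else L a

open Classical in
/-- The vertex conditions on the decorated graph: Neumann at the vertices of `Γ₀`, and the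
conditions `L` at the other vertices of each copy of `Γ₁`. -/
def decoratedConditions (Γ₀ : MetricGraph V₀ E₀) (Γ₁ : MetricGraph V₁ E₁) (v₁ : V₁)
    (L : ∀ a, Γ₁.VertexCondition a) (x : V₀ × V₁) : (Γ₀.decorate Γ₁ v₁).VertexCondition x :=
  if x.2 = v₁ then (Γ₀.decorate Γ₁ v₁).neumann x
  else (L x.2).comap
    ((LinearMap.funLeft ℂ ℂ (Γ₀.copyEnd Γ₁ v₁ x.1 x.2)).prodMap
      (LinearMap.funLeft ℂ ℂ (Γ₀.copyEnd Γ₁ v₁ x.1 x.2)))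

end MetricGraph

end

/-! The point `lam₀` itself lies in the resolvent set of H. Since the resolvent set is open
(`UnboundedOp.isOpen_resolventSet`), so does a full neighborhood of it.

Uniqueness at `lam₀`. Take on one copy of Γ₁ a solution of -u'' = lam₀ u that satisfies the
prescribed conditions away from the root and has the common value c along the copy's ends at the
root. In Green's identity between it and ψ all vertices but the root drop out, because the
conditions there are Lagrangian, and the root contributes c times the conjugate of the flux of ψ, up
to sign. The flux is not zero, so c = 0, and by simplicity the solution is a multiple tψ
(`exists_eq_smul_of_continuous_at_root`). Hence an eigenfunction of H would vanish at every vertex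
of Γ₀. As lam₀ is outside σ_D, it then vanishes on every edge of Γ₀, and the Neumann condition
reduces to t · flux(ψ) = 0 on each copy, so t = 0 (`data_eq_zero_of_decorated`).

Existence at `lam₀`. The same argument shows that lam₀ is not an eigenvalue of Γ₁ with the Neumann
condition at the root, so the inhomogeneous equation is solvable there by an alternative for
Lagrangian subspaces (`exists_projection_condData`). These solutions on the copies prescribe values
at the vertices of Γ₀. Dirichlet problems on the edges of Γ₀ extend them to the base, and the flux
missing at each vertex is supplied by a multiple of ψ. As ψ vanishes at the root, this last
correction does not spoil continuity (`exists_data_decorated`).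

For infinite Γ₀ all bounds must be uniform. The copies are identical, degrees and lengths are
bounded, and the Dirichlet problems are uniformly solvable because σ_D is closed
(`exists_bound_inv`). Everything is expressed by boundary data: on each edge the initial value and
derivative determine the solution through the explicit formula `sol`, and square summable data give
an element of L². -/

noncomputable section

/-! ### The equation `-u'' = lam u + g` on an interval -/

namespace SturmLiouville

/-- `C` and `S` are the solutions of `-u'' = lam u` with the initial data `(1, 0)` and `(0, 1)`. -/
structure IsFundamental (lam : ℝ) (C S : ℝ → ℝ) : Prop where
  cos_zero : C 0 = 1
  sin_zero : S 0 = 0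
  deriv_cos : ∀ x, HasDerivAt C (-lam * S x) x
  deriv_sin : ∀ x, HasDerivAt S (C x) x

/-- There is a fundamental system; a positive zero of `S` is the length of an interval that has
`lam` as a Dirichlet eigenvalue. -/
theorem exists_isFundamental (lam : ℝ) : ∃ C S : ℝ → ℝ, IsFundamental lam C S ∧
    ∀ l, 0 < l → S l = 0 → ∃ n : ℤ, n ≠ 0 ∧ lam = Real.pi ^ 2 * (n : ℝ) ^ 2 / l ^ 2 := by
  -- For lam ≤ 0, S is sinh(kx)/k or x and has no positive zero, so the second claim is vacuous. For
  -- lam > 0, S is sin(kx)/k, whose zeros kl = nπ give the Dirichlet eigenvalues.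
  rcases lt_trichotomy lam 0 with h | rfl | h
  · set k := √(-lam) with hk
    have hk0 : 0 < k := Real.sqrt_pos.2 (by linarith)
    have hk2 : k * k = -lam := Real.mul_self_sqrt (by linarith)
    refine ⟨fun x => Real.cosh (k * x), fun x => Real.sinh (k * x) / k,
      ⟨by simp, by simp, fun x => ?_, fun x => ?_⟩, fun l hl h0 => ?_⟩
    · refine (((hasDerivAt_id x).const_mul k).cosh).congr_deriv ?_
      rw [← hk2]
      simp only [id]
      field_simp
    · refine ((((hasDerivAt_id x).const_mul k).sinh).div_const k).congr_deriv ?_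
      simp only [id]
      field_simp
    · exact absurd h0 (div_pos (Real.sinh_pos_iff.2 (by positivity)) hk0).ne'
  · refine ⟨fun _ => 1, fun x => x, ⟨rfl, rfl, fun x => ?_, fun x => hasDerivAt_id x⟩,
      fun l hl h0 => absurd h0 hl.ne'⟩
    simpa using hasDerivAt_const x (1 : ℝ)
  · set k := √lam with hk
    have hk0 : 0 < k := Real.sqrt_pos.2 h
    have hk2 : k * k = lam := Real.mul_self_sqrt h.le
    refine ⟨fun x => Real.cos (k * x), fun x => Real.sin (k * x) / k,
      ⟨by simp, by simp, fun x => ?_, fun x => ?_⟩, fun l hl h0 => ?_⟩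
    · refine (((hasDerivAt_id x).const_mul k).cos).congr_deriv ?_
      rw [← hk2]
      simp only [id]
      field_simp
    · refine ((((hasDerivAt_id x).const_mul k).sin).div_const k).congr_deriv ?_
      simp only [id]
      field_simp
    · have h1 : Real.sin (k * l) = 0 := by
        rcases div_eq_zero_iff.1 h0 with h | h
        · exact h
        · exact absurd h hk0.ne'
      obtain ⟨n, hn⟩ := Real.sin_eq_zero_iff.1 h1
      refine ⟨n, ?_, ?_⟩
      · rintro rfl
        have : 0 < k * l := by positivity
        simp at hn
        rcases hn with h | h <;> linarith
      · have : lam * l ^ 2 = (n * Real.pi) ^ 2 := by rw [hn, ← hk2]; ring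
        field_simp
        linarith

namespace IsFundamental

variable {lam : ℝ} {C S : ℝ → ℝ}

theorem continuous_cos (h : IsFundamental lam C S) : Continuous C :=
  continuous_iff_continuousAt.2 fun x => (h.deriv_cos x).continuousAt

theorem continuous_sin (h : IsFundamental lam C S) : Continuous S :=
  continuous_iff_continuousAt.2 fun x => (h.deriv_sin x).continuousAt

/-- The derivative of the left side cancels. This is the determinant of the transfer matrix from 0
to x; it is what inverts that matrix in the later arguments. -/
theorem wronskian (h : IsFundamental lam C S) (x : ℝ) : C x * C x + lam * (S x * S x) = 1 := by
  have hd : ∀ x, HasDerivAt (fun x => C x * C x + lam * (S x * S x)) 0 x := fun x => by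
    refine (((h.deriv_cos x).mul (h.deriv_cos x)).add
      (((h.deriv_sin x).mul (h.deriv_sin x)).const_mul lam)).congr_deriv ?_
    ring
  have := is_const_of_deriv_eq_zero (fun x => (hd x).differentiableAt) (fun x => (hd x).deriv) x 0
  simpa [h.cos_zero, h.sin_zero] using this

theorem wronskian' (h : IsFundamental lam C S) (x : ℝ) :
    (C x : ℂ) * C x + lam * (S x * S x) = 1 := by
  exact_mod_cast h.wronskian x

end IsFundamental

/-- Since g is merely integrable, its primitive is only absolutely continuous, with derivative g
almost everywhere; integration by parts is used in that class. -/
theorem integral_mul_primitive_real {c c' g : ℝ → ℝ} {x : ℝ} (hc : ∀ t, HasDerivAt c (c' t) t)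
    (hc' : Continuous c') (hg : IntervalIntegrable g volume 0 x) :
    ∫ t in (0 : ℝ)..x, c t * g t =
      c x * (∫ t in (0 : ℝ)..x, g t) - ∫ t in (0 : ℝ)..x, c' t * ∫ s in (0 : ℝ)..t, g s := by
  have hcd : ContDiff ℝ 1 c := by
    rw [contDiff_one_iff_deriv]
    refine ⟨fun t => (hc t).differentiableAt, ?_⟩
    rwa [show deriv c = c' from funext fun t => (hc t).deriv]
  have h1 : AbsolutelyContinuousOnInterval c 0 x :=
    hcd.contDiffOn.absolutelyContinuousOnInterval
  have h2 := hg.absolutelyContinuousOnInterval_intervalIntegral (c := 0) left_mem_uIcc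
  have h3 := h1.integral_mul_deriv_eq_deriv_mul h2
  simp only [intervalIntegral.integral_same, mul_zero, sub_zero] at h3
  have h4 : ∫ t in (0 : ℝ)..x, c t * deriv (fun x => ∫ s in (0 : ℝ)..x, g s) t =
      ∫ t in (0 : ℝ)..x, c t * g t := by
    apply intervalIntegral.integral_congr_ae
    filter_upwards [hg.ae_hasDerivAt_integral] with t ht ht'
    rw [(ht (uIoc_subset_uIcc ht') 0 left_mem_uIcc).deriv]
  rw [← h4, h3]
  congr 1
  apply intervalIntegral.integral_congr
  intro t _
  simp only
  rw [(hc t).deriv]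

/-- Integration by parts against a primitive. -/
theorem integral_mul_primitive {c c' : ℝ → ℝ} {g : ℝ → ℂ} {x : ℝ}
    (hc : ∀ t, HasDerivAt c (c' t) t)
    (hc' : Continuous c') (hg : IntervalIntegrable g volume 0 x) :
    ∫ t in (0 : ℝ)..x, (c t : ℂ) * g t =
      c x * (∫ t in (0 : ℝ)..x, g t) - ∫ t in (0 : ℝ)..x, (c' t : ℂ) * ∫ s in (0 : ℝ)..t, g s := by
  have hcc : Continuous c := continuous_iff_continuousAt.2 fun t => (hc t).continuousAt
  have i1 : IntervalIntegrable (fun t => (c t : ℂ) * g t) volume 0 x :=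
    hg.continuousOn_mul (Complex.continuous_ofReal.comp hcc).continuousOn
  have hsub : ∀ t ∈ uIcc 0 x, IntervalIntegrable g volume 0 t := fun t ht =>
    hg.mono_set (uIcc_subset_uIcc left_mem_uIcc ht)
  have i2 : IntervalIntegrable (fun t => (c' t : ℂ) * ∫ s in (0 : ℝ)..t, g s) volume 0 x := by
    apply ContinuousOn.intervalIntegrable
    exact (Complex.continuous_ofReal.comp hc').continuousOn.mul
      (intervalIntegral.continuousOn_primitive_interval' hg left_mem_uIcc)
  -- The complex identity is checked on real and imaginary parts, which commute with multiplication
  -- by the real function c.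
  have key : ∀ T : ℂ →L[ℝ] ℝ, (∀ (r : ℝ) (z : ℂ), T (r * z) = r * T z) →
      T (∫ t in (0 : ℝ)..x, (c t : ℂ) * g t) = T (c x * (∫ t in (0 : ℝ)..x, g t) -
        ∫ t in (0 : ℝ)..x, (c' t : ℂ) * ∫ s in (0 : ℝ)..t, g s) := by
    intro T hT
    rw [map_sub, hT, ← T.intervalIntegral_comp_comm i1, ← T.intervalIntegral_comp_comm i2,
      ← T.intervalIntegral_comp_comm hg]
    simp only [hT]
    have hTg : IntervalIntegrable (fun t => T (g t)) volume 0 x :=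
      ⟨T.integrable_comp hg.1, T.integrable_comp hg.2⟩
    rw [integral_mul_primitive_real hc hc' hTg]
    congr 1
    apply intervalIntegral.integral_congr
    intro t ht
    simp only
    rw [T.intervalIntegral_comp_comm (hsub t ht)]
  apply Complex.ext
  · exact key Complex.reCLM (by simp)
  · exact key Complex.imCLM (by simp)

/-- The solution of `p'' = -lam p + g` with zero initial data. -/
def duhamel (C S : ℝ → ℝ) (g : ℝ → ℂ) (x : ℝ) : ℂ :=
  S x * (∫ t in (0 : ℝ)..x, (C t : ℂ) * g t) - C x * ∫ t in (0 : ℝ)..x, (S t : ℂ) * g t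

/-- The derivative of `duhamel`. -/
def duhamelDeriv (lam : ℝ) (C S : ℝ → ℝ) (g : ℝ → ℂ) (x : ℝ) : ℂ :=
  C x * (∫ t in (0 : ℝ)..x, (C t : ℂ) * g t) +
    lam * S x * ∫ t in (0 : ℝ)..x, (S t : ℂ) * g t

variable {lam : ℝ} {C S : ℝ → ℝ} {g : ℝ → ℂ}

theorem intervalIntegrable_ofReal_mul {c : ℝ → ℝ} (hc : Continuous c) {x : ℝ}
    (hg : IntervalIntegrable g volume 0 x) :
    IntervalIntegrable (fun t => (c t : ℂ) * g t) volume 0 x :=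
  hg.continuousOn_mul (Complex.continuous_ofReal.comp hc).continuousOn

theorem continuousOn_duhamel (h : IsFundamental lam C S) {x : ℝ}
    (hg : IntervalIntegrable g volume 0 x) : ContinuousOn (duhamel C S g) (uIcc 0 x) := by
  have hC := h.continuous_cos
  have hS := h.continuous_sin
  exact ((Complex.continuous_ofReal.comp hS).continuousOn.mul
    (intervalIntegral.continuousOn_primitive_interval'
      (intervalIntegrable_ofReal_mul hC hg) left_mem_uIcc)).sub
    ((Complex.continuous_ofReal.comp hC).continuousOn.mul
    (intervalIntegral.continuousOn_primitive_interval'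
      (intervalIntegrable_ofReal_mul hS hg) left_mem_uIcc))

/-- In the formal derivative of `duhamel` the terms S·(C g) and C·(S g) cancel, which is `e3`.
Integration by parts makes this rigorous for integrable g. -/
theorem duhamel_eq_integral (h : IsFundamental lam C S) {x : ℝ}
    (hg : IntervalIntegrable g volume 0 x) :
    duhamel C S g x = ∫ t in (0 : ℝ)..x, duhamelDeriv lam C S g t := by
  have hC := h.continuous_cos
  have hS := h.continuous_sin
  have iC := intervalIntegrable_ofReal_mul hC hg
  have iS := intervalIntegrable_ofReal_mul hS hg
  have e1 := integral_mul_primitive h.deriv_sin hC iC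
  have e2 := integral_mul_primitive h.deriv_cos (continuous_const.mul hS) iS
  have e3 : ∫ t in (0 : ℝ)..x, (S t : ℂ) * ((C t : ℂ) * g t) =
      ∫ t in (0 : ℝ)..x, (C t : ℂ) * ((S t : ℂ) * g t) := by
    congr 1; funext t; ring
  have cC := intervalIntegral.continuousOn_primitive_interval' iC left_mem_uIcc
  have cS := intervalIntegral.continuousOn_primitive_interval' iS left_mem_uIcc
  have e4 : ∫ t in (0 : ℝ)..x, duhamelDeriv lam C S g t =
      (∫ t in (0 : ℝ)..x, (C t : ℂ) * ∫ s in (0 : ℝ)..t, (C s : ℂ) * g s) -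
      ∫ t in (0 : ℝ)..x, ((-lam * S t : ℝ) : ℂ) * ∫ s in (0 : ℝ)..t, (S s : ℂ) * g s := by
    rw [← intervalIntegral.integral_sub]
    · congr 1; funext t; simp only [duhamelDeriv]; push_cast; ring
    · exact ((Complex.continuous_ofReal.comp hC).continuousOn.mul cC).intervalIntegrable
    · exact ((Complex.continuous_ofReal.comp (continuous_const.mul hS)).continuousOn.mul
        cS).intervalIntegrable
  rw [e4, duhamel]
  linear_combination e2 + e3 - e1

/-- Here the terms from differentiating the integrals add up to (C² + lam S²) g, which is g by the
Wronskian identity. -/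
theorem duhamelDeriv_eq_integral (h : IsFundamental lam C S) {x : ℝ}
    (hg : IntervalIntegrable g volume 0 x) :
    duhamelDeriv lam C S g x = ∫ t in (0 : ℝ)..x, (g t - lam * duhamel C S g t) := by
  have hC := h.continuous_cos
  have hS := h.continuous_sin
  have iC := intervalIntegrable_ofReal_mul hC hg
  have iS := intervalIntegrable_ofReal_mul hS hg
  have e1 := integral_mul_primitive h.deriv_sin hC iS
  have e2 := integral_mul_primitive h.deriv_cos (continuous_const.mul hS) iC
  have cC := intervalIntegral.continuousOn_primitive_interval' iC left_mem_uIcc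
  have cS := intervalIntegral.continuousOn_primitive_interval' iS left_mem_uIcc
  have j1 : IntervalIntegrable (fun t => (C t : ℂ) * ∫ s in (0 : ℝ)..t, (S s : ℂ) * g s)
      volume 0 x := ((Complex.continuous_ofReal.comp hC).continuousOn.mul cS).intervalIntegrable
  have j2 : IntervalIntegrable (fun t => ((-lam * S t : ℝ) : ℂ) *
      ∫ s in (0 : ℝ)..t, (C s : ℂ) * g s) volume 0 x :=
    ((Complex.continuous_ofReal.comp (continuous_const.mul hS)).continuousOn.mul
        cC).intervalIntegrable
  have j3 : IntervalIntegrable (fun t => (S t : ℂ) * ((S t : ℂ) * g t)) volume 0 x :=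
    intervalIntegrable_ofReal_mul hS iS
  have j4 : IntervalIntegrable (fun t => (C t : ℂ) * ((C t : ℂ) * g t)) volume 0 x :=
    intervalIntegrable_ofReal_mul hC iC
  have e4 : ∫ t in (0 : ℝ)..x, (g t - lam * duhamel C S g t) =
      ((∫ t in (0 : ℝ)..x, (C t : ℂ) * ((C t : ℂ) * g t)) +
      lam * (∫ t in (0 : ℝ)..x, (S t : ℂ) * ((S t : ℂ) * g t))) +
      ((∫ t in (0 : ℝ)..x, ((-lam * S t : ℝ) : ℂ) * ∫ s in (0 : ℝ)..t, (C s : ℂ) * g s) +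
      lam * ∫ t in (0 : ℝ)..x, (C t : ℂ) * ∫ s in (0 : ℝ)..t, (S s : ℂ) * g s) := by
    rw [← intervalIntegral.integral_const_mul, ← intervalIntegral.integral_const_mul,
      ← intervalIntegral.integral_add j4 (j3.const_mul _),
      ← intervalIntegral.integral_add j2 (j1.const_mul _),
      ← intervalIntegral.integral_add (j4.add (j3.const_mul _)) (j2.add (j1.const_mul _))]
    congr 1; funext t; simp only [duhamel]; push_cast
    linear_combination -(g t) * h.wronskian' t
  rw [e4, duhamelDeriv]
  linear_combination -(lam : ℂ) * e1 - e2

/-- A function with zero initial data that solves the homogeneous equation vanishes. -/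
theorem eq_zero_of_initial_zero (h : IsFundamental lam C S) {l : ℝ} (hl : 0 ≤ l) {χ dχ : ℝ → ℂ}
    (hχ : ContinuousOn χ (Icc 0 l)) (hdχ : ContinuousOn dχ (Icc 0 l))
    (h1 : ∀ x ∈ Icc 0 l, χ x = ∫ t in (0 : ℝ)..x, dχ t)
    (h2 : ∀ x ∈ Icc 0 l, dχ x = ∫ t in (0 : ℝ)..x, -lam * χ t) :
    ∀ x ∈ Icc 0 l, χ x = 0 ∧ dχ x = 0 := by
  have hder : ∀ (a b : ℝ → ℂ), ContinuousOn b (Icc 0 l) →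
      (∀ x ∈ Icc 0 l, a x = ∫ t in (0 : ℝ)..x, b t) →
      ∀ x ∈ Ico 0 l, HasDerivWithinAt a (b x) (Ici x) x := by
    intro a b hb hab x hx
    have hx' : x ∈ Icc 0 l := ⟨hx.1, hx.2.le⟩
    have hI : IntervalIntegrable b volume 0 x := by
      apply ContinuousOn.intervalIntegrable
      rw [uIcc_of_le hx.1]
      exact hb.mono (Icc_subset_Icc_right hx.2.le)
    have hnx : Icc 0 l ∈ 𝓝[>] x :=
      mem_of_superset (Ioo_mem_nhdsGT hx.2) fun y hy => ⟨hx.1.trans hy.1.le, hy.2.le⟩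
    have hc : ContinuousWithinAt b (Ioi x) x :=
      (hb x hx').mono_of_mem_nhdsWithin hnx
    have := intervalIntegral.integral_hasDerivWithinAt_right hI
      (s := Ici x) (t := Ioi x)
      (hb.stronglyMeasurableAtFilter_nhdsWithin measurableSet_Icc x |>.filter_mono
        (nhdsWithin_le_of_mem hnx)) hc
    have hnx' : Icc 0 l ∈ 𝓝[≥] x :=
      mem_of_superset (Ico_mem_nhdsGE hx.2) fun y hy => ⟨hx.1.trans hy.1, hy.2.le⟩
    exact this.congr_of_eventuallyEq (mem_of_superset hnx' hab) (hab x hx')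
  have d1 := hder χ dχ hdχ h1
  have d2 := hder dχ (fun t => -lam * χ t) (continuousOn_const.mul hχ) h2
  have cC : Continuous fun x => (C x : ℂ) := Complex.continuous_ofReal.comp h.continuous_cos
  have cS : Continuous fun x => (S x : ℂ) := Complex.continuous_ofReal.comp h.continuous_sin
  have k0 : χ 0 = 0 := by simpa using h1 0 (left_mem_Icc.2 hl)
  have k0' : dχ 0 = 0 := by simpa using h2 0 (left_mem_Icc.2 hl)
  -- The inverse transfer matrix applied to (χ, dχ) is constant along the interval, hence zero by
  -- the initial data. The Wronskian identity then recovers χ and dχ from `A` and `B`.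
  have A := constant_of_has_deriv_right_zero (f := fun x => C x * χ x - S x * dχ x)
    ((cC.continuousOn.mul hχ).sub (cS.continuousOn.mul hdχ)) (fun x hx => by
      refine ((((h.deriv_cos x).ofReal_comp.hasDerivWithinAt).mul (d1 x hx)).sub
        (((h.deriv_sin x).ofReal_comp.hasDerivWithinAt).mul (d2 x hx))).congr_deriv ?_
      push_cast; ring)
  have B := constant_of_has_deriv_right_zero (f := fun x => lam * (S x * χ x) + C x * dχ x)
    ((continuousOn_const.mul (cS.continuousOn.mul hχ)).add (cC.continuousOn.mul hdχ))
    (fun x hx => by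
      refine (((((h.deriv_sin x).ofReal_comp.hasDerivWithinAt).mul (d1 x hx)).const_mul
        (lam : ℂ)).add
        (((h.deriv_cos x).ofReal_comp.hasDerivWithinAt).mul (d2 x hx))).congr_deriv ?_
      push_cast; ring)
  intro x hx
  have a := A x hx
  have b := B x hx
  simp only [k0, k0', mul_zero, sub_zero, add_zero] at a b
  have w := h.wronskian' x
  constructor
  · linear_combination (-χ x) * w + C x * a + S x * b
  · linear_combination (-dχ x) * w + C x * b - lam * S x * a

end SturmLiouville

/-! ### Explicit solutions of the inhomogeneous equation and their uniform bounds -/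

namespace SturmLiouville

variable {lam : ℝ} {C S : ℝ → ℝ} {g : ℝ → ℂ}

/-- The solution of `-u'' = lam u + g` with initial data `(a, b)`. -/
def sol (C S : ℝ → ℝ) (a b : ℂ) (g : ℝ → ℂ) (x : ℝ) : ℂ :=
  a * C x + b * S x - duhamel C S g x

/-- The derivative of `sol`. -/
def solDeriv (lam : ℝ) (C S : ℝ → ℝ) (a b : ℂ) (g : ℝ → ℂ) (x : ℝ) : ℂ :=
  -lam * a * S x + b * C x - duhamelDeriv lam C S g x

theorem sol_eq_add (a b : ℂ) (g : ℝ → ℂ) (x : ℝ) :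
    sol C S a b g x = a * C x + b * S x + sol C S 0 0 g x := by
  simp only [sol]; ring

theorem solDeriv_eq_add (a b : ℂ) (g : ℝ → ℂ) (x : ℝ) :
    solDeriv lam C S a b g x = -lam * a * S x + b * C x + solDeriv lam C S 0 0 g x := by
  simp only [solDeriv]; ring

theorem sol_zero (h : IsFundamental lam C S) (a b : ℂ) : sol C S a b g 0 = a := by
  simp [sol, duhamel, h.cos_zero, h.sin_zero]

theorem solDeriv_zero (h : IsFundamental lam C S) (a b : ℂ) : solDeriv lam C S a b g 0 = b := by
  simp [solDeriv, duhamelDeriv, h.cos_zero, h.sin_zero]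

theorem continuousOn_duhamelDeriv (h : IsFundamental lam C S) {x : ℝ}
    (hg : IntervalIntegrable g volume 0 x) :
    ContinuousOn (duhamelDeriv lam C S g) (uIcc 0 x) := by
  have hC := h.continuous_cos
  have hS := h.continuous_sin
  exact ((Complex.continuous_ofReal.comp hC).continuousOn.mul
    (intervalIntegral.continuousOn_primitive_interval'
      (intervalIntegrable_ofReal_mul hC hg) left_mem_uIcc)).add
    ((continuousOn_const.mul (Complex.continuous_ofReal.comp hS).continuousOn).mul
    (intervalIntegral.continuousOn_primitive_interval'
      (intervalIntegrable_ofReal_mul hS hg) left_mem_uIcc))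

theorem continuousOn_sol (h : IsFundamental lam C S) {x : ℝ}
    (hg : IntervalIntegrable g volume 0 x) (a b : ℂ) :
    ContinuousOn (sol C S a b g) (uIcc 0 x) :=
  ((continuousOn_const.mul
    (Complex.continuous_ofReal.comp h.continuous_cos).continuousOn).add
    (continuousOn_const.mul
      (Complex.continuous_ofReal.comp h.continuous_sin).continuousOn)).sub
    (continuousOn_duhamel h hg)

theorem continuousOn_solDeriv (h : IsFundamental lam C S) {x : ℝ}
    (hg : IntervalIntegrable g volume 0 x) (a b : ℂ) :
    ContinuousOn (solDeriv lam C S a b g) (uIcc 0 x) :=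
  ((continuousOn_const.mul
    (Complex.continuous_ofReal.comp h.continuous_sin).continuousOn).add
    (continuousOn_const.mul
      (Complex.continuous_ofReal.comp h.continuous_cos).continuousOn)).sub
    (continuousOn_duhamelDeriv h hg)

theorem sol_eq_integral (h : IsFundamental lam C S) {x : ℝ}
    (hg : IntervalIntegrable g volume 0 x) (a b : ℂ) :
    sol C S a b g x = a + ∫ t in (0 : ℝ)..x, solDeriv lam C S a b g t := by
  have cC : Continuous fun x => (C x : ℂ) := Complex.continuous_ofReal.comp h.continuous_cos
  have cS : Continuous fun x => (S x : ℂ) := Complex.continuous_ofReal.comp h.continuous_sin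
  have hc : Continuous fun t => -lam * a * (S t : ℂ) + b * C t := by fun_prop
  have e : ∫ t in (0 : ℝ)..x, (-lam * a * (S t : ℂ) + b * C t) =
      (a * C x + b * S x) - (a * C 0 + b * S 0) := by
    apply intervalIntegral.integral_eq_sub_of_hasDerivAt
      (f := fun t => a * (C t : ℂ) + b * S t)
    · intro t _
      refine (((h.deriv_cos t).ofReal_comp.const_mul a).add
        ((h.deriv_sin t).ofReal_comp.const_mul b)).congr_deriv ?_
      push_cast; ring
    · exact hc.intervalIntegrable _ _
  simp only [solDeriv]
  rw [intervalIntegral.integral_sub (hc.intervalIntegrable _ _)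
    (continuousOn_duhamelDeriv h hg).intervalIntegrable, e, ← duhamel_eq_integral h hg, sol,
    h.cos_zero, h.sin_zero]
  push_cast; ring

theorem solDeriv_eq_integral (h : IsFundamental lam C S) {x : ℝ}
    (hg : IntervalIntegrable g volume 0 x) (a b : ℂ) :
    solDeriv lam C S a b g x = b + ∫ t in (0 : ℝ)..x, -(g t + lam * sol C S a b g t) := by
  have cC : Continuous fun x => (C x : ℂ) := Complex.continuous_ofReal.comp h.continuous_cos
  have cS : Continuous fun x => (S x : ℂ) := Complex.continuous_ofReal.comp h.continuous_sin
  have hc : Continuous fun t => -lam * (a * C t + b * (S t : ℂ)) := by fun_prop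
  have e : ∫ t in (0 : ℝ)..x, (-lam * (a * C t + b * (S t : ℂ))) =
      (-lam * a * S x + b * C x) - (-lam * a * S 0 + b * C 0) := by
    apply intervalIntegral.integral_eq_sub_of_hasDerivAt
      (f := fun t => -lam * a * (S t : ℂ) + b * C t)
    · intro t _
      refine (((h.deriv_sin t).ofReal_comp.const_mul (-lam * a)).add
        ((h.deriv_cos t).ofReal_comp.const_mul b)).congr_deriv ?_
      push_cast; ring
    · exact hc.intervalIntegrable _ _
  have e' : (fun t => -(g t + lam * sol C S a b g t)) = fun t =>
      (-lam * (a * C t + b * (S t : ℂ))) - (g t - lam * duhamel C S g t) := by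
    funext t; simp only [sol]; ring
  have i : IntervalIntegrable (fun t => g t - lam * duhamel C S g t) volume 0 x :=
    hg.sub ((continuousOn_duhamel h hg).intervalIntegrable.const_mul _)
  rw [e', intervalIntegral.integral_sub (hc.intervalIntegrable _ _) i, e,
    ← duhamelDeriv_eq_integral h hg, solDeriv,
    h.cos_zero, h.sin_zero]
  push_cast; ring

/-- Every solution of `-u'' = lam u + g` is given by `sol`. -/
theorem eq_sol (h : IsFundamental lam C S) {l : ℝ} (hl : 0 ≤ l)
    (hg : IntervalIntegrable g volume 0 l) {φ dφ : ℝ → ℂ}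
    (h1 : ∀ x ∈ Icc 0 l, φ x = φ 0 + ∫ t in (0 : ℝ)..x, dφ t)
    (h2 : ∀ x ∈ Icc 0 l, dφ x = dφ 0 + ∫ t in (0 : ℝ)..x, -(g t + lam * φ t))
    (hφ : ContinuousOn φ (Icc 0 l)) (hdφ : ContinuousOn dφ (Icc 0 l)) :
    ∀ x ∈ Icc 0 l, φ x = sol C S (φ 0) (dφ 0) g x ∧
      dφ x = solDeriv lam C S (φ 0) (dφ 0) g x := by
  have hu := uIcc_of_le hl
  have hsub : ∀ x ∈ Icc 0 l, Icc 0 x ⊆ Icc 0 l := fun x hx => Icc_subset_Icc_right hx.2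
  have gx : ∀ x ∈ Icc 0 l, IntervalIntegrable g volume 0 x := fun x hx =>
    hg.mono_set (by rw [uIcc_of_le hx.1, hu]; exact hsub x hx)
  have cI : ∀ (c : ℝ → ℂ), ContinuousOn c (Icc 0 l) → ∀ x ∈ Icc 0 l,
      IntervalIntegrable c volume 0 x := fun c hc x hx => by
    apply ContinuousOn.intervalIntegrable
    rw [uIcc_of_le hx.1]; exact hc.mono (hsub x hx)
  have c1 := continuousOn_sol h hg (φ 0) (dφ 0)
  have c2 := continuousOn_solDeriv h hg (φ 0) (dφ 0)
  rw [hu] at c1 c2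
  -- The difference between φ and the explicit solution with the same initial data solves the
  -- homogeneous equation with zero initial data.
  have := eq_zero_of_initial_zero h hl (hφ.sub c1) (hdφ.sub c2) (fun x hx => by
      simp only [Pi.sub_apply]
      rw [intervalIntegral.integral_sub (cI _ hdφ x hx) (cI _ c2 x hx), h1 x hx,
        sol_eq_integral h (gx x hx)]
      ring) (fun x hx => by
      simp only [Pi.sub_apply]
      have e : (fun t => -(lam : ℂ) * (φ t - sol C S (φ 0) (dφ 0) g t)) = fun t =>
        -(g t + lam * φ t) - -(g t + lam * sol C S (φ 0) (dφ 0) g t) := by funext t; ring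
      have j1 : IntervalIntegrable (fun t => -(g t + lam * φ t)) volume 0 x :=
        ((gx x hx).add ((cI _ hφ x hx).const_mul (lam : ℂ))).neg
      have j2 : IntervalIntegrable (fun t => -(g t + lam * sol C S (φ 0) (dφ 0) g t))
          volume 0 x := ((gx x hx).add ((cI _ c1 x hx).const_mul (lam : ℂ))).neg
      rw [e, intervalIntegral.integral_sub j1 j2, h2 x hx, solDeriv_eq_integral h (gx x hx)]
      ring)
  exact fun x hx => ⟨sub_eq_zero.1 (this x hx).1, sub_eq_zero.1 (this x hx).2⟩

theorem norm_integral_mul_le {c : ℝ → ℝ} {M l x : ℝ} (hM : ∀ t ∈ Icc 0 l, |c t| ≤ M)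
    (hg : IntervalIntegrable g volume 0 l) (hx : x ∈ Icc 0 l) :
    ‖∫ t in (0 : ℝ)..x, (c t : ℂ) * g t‖ ≤ M * ∫ t in (0 : ℝ)..l, ‖g t‖ := by
  have hl : 0 ≤ l := hx.1.trans hx.2
  have hM0 : 0 ≤ M := (abs_nonneg _).trans (hM 0 (left_mem_Icc.2 hl))
  have hg' := hg.norm
  have hgx : IntervalIntegrable (fun t => ‖g t‖) volume 0 x :=
    hg'.mono_set (by rw [uIcc_of_le hx.1, uIcc_of_le hl]; exact Icc_subset_Icc_right hx.2)
  calc ‖∫ t in (0 : ℝ)..x, (c t : ℂ) * g t‖ ≤ ∫ t in (0 : ℝ)..x, M * ‖g t‖ := by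
        apply intervalIntegral.norm_integral_le_of_norm_le hx.1 _ (hgx.const_mul M)
        refine Eventually.of_forall fun t ht => ?_
        rw [norm_mul, Complex.norm_real]
        exact mul_le_mul_of_nonneg_right (hM t ⟨ht.1.le, ht.2.trans hx.2⟩) (norm_nonneg _)
    _ = M * ∫ t in (0 : ℝ)..x, ‖g t‖ := intervalIntegral.integral_const_mul _ _
    _ ≤ M * ∫ t in (0 : ℝ)..l, ‖g t‖ := by
        refine mul_le_mul_of_nonneg_left ?_ hM0
        exact intervalIntegral.integral_mono_interval le_rfl hx.1 hx.2
          (Eventually.of_forall fun _ => norm_nonneg _) hg'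

theorem intervalIntegrable_Lp {l : ℝ} (hl : 0 ≤ l)
    (g : Lp ℂ 2 (volume.restrict (Ioc 0 l))) : IntervalIntegrable g volume 0 l := by
  rw [intervalIntegrable_iff_integrableOn_Ioc_of_le hl]
  exact (Lp.memLp g).integrable (by norm_num)

/-- Cauchy–Schwarz on an interval of measure l. -/
theorem integral_norm_Lp_le {l : ℝ} (hl : 0 ≤ l)
    (g : Lp ℂ 2 (volume.restrict (Ioc 0 l))) : ∫ t in (0 : ℝ)..l, ‖g t‖ ≤ √l * ‖g‖ := by
  rw [intervalIntegral.integral_of_le hl]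
  have hi : Integrable g (volume.restrict (Ioc 0 l)) := (Lp.memLp g).integrable (by norm_num)
  have h1 := eLpNorm_le_eLpNorm_mul_rpow_measure_univ (μ := volume.restrict (Ioc 0 l))
    (p := 1) (q := 2) (by norm_num) (Lp.aestronglyMeasurable g)
  have h2 : ENNReal.ofReal (∫ t in Ioc 0 l, ‖g t‖) ≤ ENNReal.ofReal (√l * ‖g‖) := by
    rw [ofReal_integral_norm_eq_lintegral_enorm hi, ← eLpNorm_one_eq_lintegral_enorm]
    refine h1.trans (le_of_eq ?_)
    rw [← Lp.enorm_def, mul_comm, ENNReal.ofReal_mul (Real.sqrt_nonneg _), ofReal_norm]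
    congr 1
    simp only [Measure.restrict_apply_univ, Real.volume_Ioc, sub_zero, ENNReal.toReal_one,
      ENNReal.toReal_ofNat]
    rw [ENNReal.ofReal_rpow_of_nonneg hl (by norm_num), Real.sqrt_eq_rpow]
    norm_num
  exact (ENNReal.ofReal_le_ofReal_iff (by positivity)).1 h2

/-- Uniform bounds for the solutions on the intervals of bounded length. -/
theorem exists_bound_sol (h : IsFundamental lam C S) (m : ℝ) : ∃ K : ℝ, 0 < K ∧
    ∀ l, 0 < l → l ≤ m → ∀ (g : Lp ℂ 2 (volume.restrict (Ioc 0 l))) (a b : ℂ), ∀ x ∈ Icc 0 l,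
      ‖sol C S a b g x‖ ≤ K * (‖a‖ + ‖b‖ + ‖g‖) ∧
      ‖solDeriv lam C S a b g x‖ ≤ K * (‖a‖ + ‖b‖ + ‖g‖) := by
  obtain ⟨M₁, h₁⟩ := (isCompact_Icc (a := (0 : ℝ)) (b := m)).exists_bound_of_continuousOn
    h.continuous_cos.continuousOn
  obtain ⟨M₂, h₂⟩ := (isCompact_Icc (a := (0 : ℝ)) (b := m)).exists_bound_of_continuousOn
    h.continuous_sin.continuousOn
  set M := max 1 (max M₁ M₂) with hM
  have hM1 : 1 ≤ M := le_max_left _ _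
  have hM0 : 0 ≤ M := zero_le_one.trans hM1
  -- M bounds |C| and |S| on [0, m]. The initial data enter with one factor M, each of the two
  -- Duhamel terms with M · M · √m, and the coefficient lam in `solDeriv` costs the factor 1 +
  -- |lam|.
  refine ⟨(1 + |lam|) * (M + 2 * M * M * √m), by positivity, ?_⟩
  intro l hl hlm g a b x hx
  have hC : ∀ t ∈ Icc 0 l, |C t| ≤ M := fun t ht =>
    (h₁ t ⟨ht.1, ht.2.trans hlm⟩).trans ((le_max_left _ _).trans (le_max_right _ _))
  have hS : ∀ t ∈ Icc 0 l, |S t| ≤ M := fun t ht =>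
    (h₂ t ⟨ht.1, ht.2.trans hlm⟩).trans ((le_max_right _ _).trans (le_max_right _ _))
  have hgi := intervalIntegrable_Lp hl.le g
  have hG : ∫ t in (0 : ℝ)..l, ‖g t‖ ≤ √m * ‖g‖ := (integral_norm_Lp_le hl.le g).trans
    (mul_le_mul_of_nonneg_right (Real.sqrt_le_sqrt hlm) (norm_nonneg _))
  have A := (norm_integral_mul_le hC hgi hx).trans (mul_le_mul_of_nonneg_left hG hM0)
  have B := (norm_integral_mul_le hS hgi hx).trans (mul_le_mul_of_nonneg_left hG hM0)
  have hCx := hC x hx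
  have hSx := hS x hx
  set X := ∫ t in (0 : ℝ)..x, (C t : ℂ) * g t
  set Y := ∫ t in (0 : ℝ)..x, (S t : ℂ) * g t
  have hK : M * (‖a‖ + ‖b‖) + 2 * (M * (M * (√m * ‖g‖))) ≤
      (M + 2 * M * M * √m) * (‖a‖ + ‖b‖ + ‖g‖) := by
    have : 0 ≤ M * ‖g‖ + 2 * M * M * √m * (‖a‖ + ‖b‖) := by positivity
    linarith
  have hT : 0 ≤ M * (‖a‖ + ‖b‖) + 2 * (M * (M * (√m * ‖g‖))) := by positivity
  have hmul : ∀ (c : ℝ) (z : ℂ) (r : ℝ), |c| ≤ M → ‖z‖ ≤ r → ‖(c : ℂ) * z‖ ≤ M * r := by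
    intro c z r hc hz
    rw [norm_mul, Complex.norm_real]
    exact mul_le_mul hc hz (norm_nonneg _) hM0
  have a1 := hmul _ a _ hCx le_rfl
  have a2 := hmul _ a _ hSx le_rfl
  have b1 := hmul _ b _ hCx le_rfl
  have b2 := hmul _ b _ hSx le_rfl
  have X1 := hmul _ X _ hCx A
  have X2 := hmul _ X _ hSx A
  have Y1 := hmul _ Y _ hCx B
  have Y2 := hmul _ Y _ hSx B
  constructor
  · have e : sol C S a b g x = (C x * a + S x * b) - (S x * X - C x * Y) := by
      simp only [sol, duhamel, X, Y]; ring
    rw [e]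
    have n1 := norm_sub_le ((C x : ℂ) * a + S x * b) (S x * X - C x * Y)
    have n2 := norm_add_le ((C x : ℂ) * a) (S x * b)
    have n3 := norm_sub_le ((S x : ℂ) * X) (C x * Y)
    have : ‖(C x * a + S x * b) - (S x * X - C x * Y)‖ ≤
      M * (‖a‖ + ‖b‖) + 2 * (M * (M * (√m * ‖g‖))) := by linarith
    refine (this.trans hK).trans ?_
    have hP : 0 ≤ (M + 2 * M * M * √m) * (‖a‖ + ‖b‖ + ‖g‖) := by positivity
    linarith [mul_nonneg (abs_nonneg lam) hP]
  · have e : solDeriv lam C S a b g x = (C x * b - C x * X) - lam * (S x * a + S x * Y) := by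
      simp only [solDeriv, duhamelDeriv, X, Y]; ring
    rw [e]
    have n1 := norm_sub_le ((C x : ℂ) * b - C x * X) (lam * (S x * a + S x * Y))
    have n2 := norm_add_le ((S x : ℂ) * a) (S x * Y)
    have n3 := norm_sub_le ((C x : ℂ) * b) (C x * X)
    have n4 : ‖(lam : ℂ) * (S x * a + S x * Y)‖ ≤
        |lam| * (M * (‖a‖ + ‖b‖) + 2 * (M * (M * (√m * ‖g‖)))) := by
      rw [norm_mul, Complex.norm_real]
      refine mul_le_mul_of_nonneg_left ?_ (abs_nonneg _)
      have : 0 ≤ M * ‖b‖ + M * (M * (√m * ‖g‖)) := by positivity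
      linarith
    have n5 : ‖(C x : ℂ) * b - C x * X‖ ≤
        1 * (M * (‖a‖ + ‖b‖) + 2 * (M * (M * (√m * ‖g‖)))) := by
      have : 0 ≤ M * ‖a‖ + M * (M * (√m * ‖g‖)) := by positivity
      linarith
    rw [mul_assoc]
    refine le_trans ?_ (mul_le_mul_of_nonneg_left hK (by positivity))
    linarith

/-- The solutions as elements of `L²`, with uniform bounds. -/
theorem exists_Lp_sol (h : IsFundamental lam C S) (m : ℝ) : ∃ K : ℝ, 0 < K ∧
    ∀ l, 0 < l → l ≤ m → ∀ (g : Lp ℂ 2 (volume.restrict (Ioc 0 l))) (a b : ℂ),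
      ∃ u : Lp ℂ 2 (volume.restrict (Ioc 0 l)),
        u =ᵐ[volume.restrict (Ioc 0 l)] sol C S a b g ∧ ‖u‖ ≤ K * (‖a‖ + ‖b‖ + ‖g‖) := by
  obtain ⟨K, hK0, hK⟩ := exists_bound_sol h m
  refine ⟨(1 + √m) * K, by positivity, fun l hl hlm g a b => ?_⟩
  have hb : ∀ᵐ x ∂volume.restrict (Ioc 0 l),
      ‖sol C S a b g x‖ ≤ K * (‖a‖ + ‖b‖ + ‖g‖) := by
    filter_upwards [ae_restrict_mem measurableSet_Ioc] with x hx
    exact (hK l hl hlm g a b x (Ioc_subset_Icc_self hx)).1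
  have hc := continuousOn_sol h (intervalIntegrable_Lp hl.le g) a b
  rw [uIcc_of_le hl.le] at hc
  have hm : AEStronglyMeasurable (sol C S a b g) (volume.restrict (Ioc 0 l)) :=
    (hc.mono Ioc_subset_Icc_self).aestronglyMeasurable measurableSet_Ioc
  have hL : MemLp (sol C S a b g) 2 (volume.restrict (Ioc 0 l)) := MemLp.of_bound hm _ hb
  refine ⟨hL.toLp _, hL.coeFn_toLp, ?_⟩
  have h1 := Lp.norm_le_of_ae_bound (f := hL.toLp _) (C := K * (‖a‖ + ‖b‖ + ‖g‖))
    (by positivity) (by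
    filter_upwards [hL.coeFn_toLp, hb] with x hx hx'
    rwa [hx])
  refine h1.trans ?_
  rw [mul_assoc]
  refine mul_le_mul_of_nonneg_right ?_ (by positivity)
  have : (measureUnivNNReal (volume.restrict (Ioc 0 l)) : ℝ) = l := by
    simp [measureUnivNNReal, ENNReal.coe_toNNReal_eq_toReal, hl.le]
  rw [this, ENNReal.toReal_ofNat, ← one_div, ← Real.sqrt_eq_rpow]
  linarith [Real.sqrt_le_sqrt hlm]

end SturmLiouville

/-! ### Unbounded operators -/

namespace UnboundedOp

variable {X : Type*} [NormedAddCommGroup X] [NormedSpace ℂ X]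

/-- T - z' = (1 - (z' - z) R)(T - z), and the first factor is a unit for z' near z. The new
resolvent is R (1 - (z' - z) R)⁻¹. -/
theorem isOpen_resolventSet [CompleteSpace X] (T : X →ₗ.[ℂ] X) : IsOpen (resolventSet T) := by
  rw [isOpen_iff_mem_nhds]
  rintro z ⟨R, hR, hR'⟩
  have hc : Tendsto (fun z' : ℂ => 1 - (z' - z) • R) (𝓝 z) (𝓝 (1 : X →L[ℂ] X)) := by
    have : Continuous fun z' : ℂ => 1 - (z' - z) • R := by fun_prop
    simpa using this.tendsto z
  have hu : ∀ᶠ z' in 𝓝 z, IsUnit (1 - (z' - z) • R) :=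
    hc.eventually (Units.isOpen.mem_nhds isUnit_one)
  filter_upwards [hu] with z' hz'
  obtain ⟨A, hA⟩ := hz'
  have hA1 : ∀ f, (A : X →L[ℂ] X) ((↑A⁻¹ : X →L[ℂ] X) f) = f := fun f => by
    rw [← mul_apply_eq_comp, Units.mul_inv, one_apply_eq_self]
  have hA2 : ∀ f, (↑A⁻¹ : X →L[ℂ] X) ((A : X →L[ℂ] X) f) = f := fun f => by
    rw [← mul_apply_eq_comp, Units.inv_mul, one_apply_eq_self]
  have hAf : ∀ f, (A : X →L[ℂ] X) f = f - (z' - z) • R f := fun f => by simp [hA]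
  refine ⟨R * (↑A⁻¹ : X →L[ℂ] X), fun f => ?_, fun u => ?_⟩
  · obtain ⟨h, e⟩ := hR ((↑A⁻¹ : X →L[ℂ] X) f)
    refine ⟨h, ?_⟩
    have h1 := hA1 f
    rw [hAf] at h1
    set v := (↑A⁻¹ : X →L[ℂ] X) f
    calc T ⟨R v, h⟩ - z' • R v = (T ⟨R v, h⟩ - z • R v) - (z' - z) • R v := by
          rw [sub_smul]; abel
      _ = f := by rw [e, h1]
  · have h1 := hA2 (T u - z • (u : X))
    rw [hAf, hR'] at h1
    have h2 : T u - z' • (u : X) = T u - z • (u : X) - (z' - z) • (u : X) := by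
      rw [sub_smul]; abel
    rw [mul_apply_eq_comp, h2, h1, hR']

/-- An operator `T - z` that is bounded below and onto has a bounded inverse. -/
theorem mem_resolventSet_of_bijective {T : X →ₗ.[ℂ] X} {z : ℂ} (K : ℝ)
    (hinj : ∀ u : T.domain, T u = z • (u : X) → (u : X) = 0)
    (hsurj : ∀ f : X, ∃ u : T.domain, T u - z • (u : X) = f ∧ ‖(u : X)‖ ≤ K * ‖f‖) :
    z ∈ resolventSet T := by
  choose R hR hK using hsurj
  have huniq : ∀ u v : T.domain, T u - z • (u : X) = T v - z • (v : X) → (u : X) = v := by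
    intro u v h
    have := hinj (u - v) (by
      rw [T.map_sub, Submodule.coe_sub, smul_sub, ← sub_eq_zero]
      rw [← sub_eq_zero] at h
      rw [← h]; abel)
    simpa [sub_eq_zero] using this
  -- The preimages were chosen one f at a time; injectivity makes the choice linear.
  let R' : X →ₗ[ℂ] X :=
    { toFun := fun f => R f
      map_add' := fun f g => by
        rw [← Submodule.coe_add]
        refine huniq _ _ ?_
        rw [hR, T.map_add, Submodule.coe_add, smul_add]
        nth_rw 1 [← hR f, ← hR g]
        abel
      map_smul' := fun c f => by
        rw [RingHom.id_apply, ← Submodule.coe_smul]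
        refine huniq _ _ ?_
        rw [hR, T.map_smul, Submodule.coe_smul, smul_comm z c, ← smul_sub, hR] }
  refine ⟨R'.mkContinuous K hK, fun f => ⟨(R f).2, hR f⟩, fun u => ?_⟩
  exact huniq _ _ (hR _)

end UnboundedOp

/-! ### Square sums -/

theorem ENNReal.add_sq_le (a b : ENNReal) : (a + b) ^ 2 ≤ 2 * (a ^ 2 + b ^ 2) := by
  have := ENNReal.rpow_add_le_mul_rpow_add_rpow a b (p := 2) (by norm_num)
  norm_num at this
  exact_mod_cast this

/-- Turns a pointwise norm bound into one for extended squares, which can be summed over edges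
without a summability condition. The 4 comes from using (a + b)² ≤ 2(a² + b²) twice. -/
theorem enorm_sq_le_of_norm_le {G₁ G₂ G₃ G₄ : Type*} [SeminormedAddCommGroup G₁]
    [SeminormedAddCommGroup G₂] [SeminormedAddCommGroup G₃] [SeminormedAddCommGroup G₄]
    {x : G₁} {a : G₂} {b : G₃} {g : G₄} {K : NNReal} (h : ‖x‖ ≤ K * (‖a‖ + ‖b‖ + ‖g‖)) :
    ‖x‖ₑ ^ 2 ≤ ((4 * K ^ 2 : NNReal) : ENNReal) * (‖a‖ₑ ^ 2 + ‖b‖ₑ ^ 2 + ‖g‖ₑ ^ 2) := by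
  have h1 : ‖x‖ₑ ≤ K * (‖a‖ₑ + ‖b‖ₑ + ‖g‖ₑ) := by
    have h1 : ‖x‖₊ ≤ K * (‖a‖₊ + ‖b‖₊ + ‖g‖₊) := by exact_mod_cast h
    have h2 := ENNReal.coe_le_coe.2 h1
    push_cast at h2
    exact h2
  calc ‖x‖ₑ ^ 2 ≤ (K * (‖a‖ₑ + ‖b‖ₑ + ‖g‖ₑ)) ^ 2 := by gcongr
    _ = K ^ 2 * (‖a‖ₑ + ‖b‖ₑ + ‖g‖ₑ) ^ 2 := by rw [mul_pow]
    _ ≤ K ^ 2 * (2 * (2 * (‖a‖ₑ ^ 2 + ‖b‖ₑ ^ 2) + 2 * ‖g‖ₑ ^ 2)) := by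
        gcongr
        refine (ENNReal.add_sq_le _ _).trans ?_
        gcongr
        · exact ENNReal.add_sq_le _ _
        · exact le_mul_of_one_le_left (by positivity) (by norm_num)
    _ = _ := by push_cast; ring

theorem ENNReal.sum_sq_le {ι : Type*} (s : Finset ι) (f : ι → ENNReal) :
    (∑ i ∈ s, f i) ^ 2 ≤ s.card * ∑ i ∈ s, f i ^ 2 := by
  have := ENNReal.rpow_sum_le_const_mul_sum_rpow (s := s) (f := f) (p := 2) (by norm_num)
  norm_num at this
  exact_mod_cast this

theorem lp.enorm_sq_eq_tsum {ι : Type*} {G : ι → Type*} [∀ i, NormedAddCommGroup (G i)]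
    (x : lp G 2) : ‖x‖ₑ ^ 2 = ∑' i, ‖x i‖ₑ ^ 2 := by
  have h := lp.norm_rpow_eq_tsum (p := 2) (by norm_num) x
  have hs := (lp.memℓp x).summable (p := 2) (by norm_num)
  simp only [ENNReal.toReal_ofNat, Real.rpow_two] at h hs
  rw [← ofReal_norm, ← ENNReal.ofReal_pow (norm_nonneg _), h,
    ENNReal.ofReal_tsum_of_nonneg (fun _ => by positivity) hs]
  simp only [ENNReal.ofReal_pow (norm_nonneg _), ofReal_norm]

theorem memℓp_two_of_tsum_ne_top {ι : Type*} {G : ι → Type*} [∀ i, NormedAddCommGroup (G i)]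
    {x : ∀ i, G i} (h : ∑' i, ‖x i‖ₑ ^ 2 ≠ ⊤) : Memℓp x 2 := by
  rw [memℓp_gen_iff (by norm_num)]
  have := ENNReal.summable_toReal h
  simpa using this

/-! ### The eigenvalue equation on a metric graph -/

namespace MetricGraph

open SturmLiouville

variable {V E : Type*} {Γ : MetricGraph V E} {lam : ℝ} {C S : ℝ → ℝ}

/-- The boundary data `F, F'` are those of a solution of `-u'' = lam u + f`. -/
def IsSolutionData (Γ : MetricGraph V E) (lam : ℝ) (C S : ℝ → ℝ) (f : Γ.L2)
    (F F' : E × Bool → ℂ) : Prop :=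
  ∀ e, F (e, true) = sol C S (F (e, false)) (F' (e, false)) (f e) (Γ.len e) ∧
    F' (e, true) = -solDeriv lam C S (F (e, false)) (F' (e, false)) (f e) (Γ.len e)

theorem coeFn_eq_ae (f u : Γ.L2) (e : E) :
    ((-(f + (lam : ℂ) • u) : Γ.L2) e : ℝ → ℂ) =ᵐ[Γ.edgeMeasure e]
      fun t => -((f e : ℝ → ℂ) t + lam * (u e : ℝ → ℂ) t) := by
  have h1 := Lp.coeFn_neg ((f + (lam : ℂ) • u : Γ.L2) e)
  have h2 := Lp.coeFn_add (f e) ((lam : ℂ) • u e)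
  have h3 := Lp.coeFn_smul (lam : ℂ) (u e)
  filter_upwards [h1, h2, h3] with t h1 h2 h3
  simp only [lp.coeFn_neg, lp.coeFn_add, lp.coeFn_smul, Pi.neg_apply, Pi.add_apply,
    Pi.smul_apply, smul_eq_mul] at h1 h2 h3 ⊢
  rw [h1, h2, h3]

theorem integral_congr_edge {l : ℝ} {w w' : ℝ → ℂ} (h : w =ᵐ[volume.restrict (Ioc 0 l)] w')
    {x : ℝ} (hx : x ∈ Icc 0 l) : ∫ t in (0 : ℝ)..x, w t = ∫ t in (0 : ℝ)..x, w' t := by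
  apply intervalIntegral.integral_congr_ae
  rw [Filter.EventuallyEq, ae_restrict_iff' measurableSet_Ioc] at h
  rw [uIoc_of_le hx.1]
  filter_upwards [h] with t ht hm using ht ⟨hm.1, hm.2.trans hx.2⟩

/-- An `H²` solution is given by `sol` on every edge. -/
theorem IsH2.eq_sol (h : IsFundamental lam C S) {f u : Γ.L2} {F F' : E × Bool → ℂ}
    (hu : Γ.IsH2 u (-(f + (lam : ℂ) • u)) F F') :
    Γ.IsSolutionData lam C S f F F' ∧
      ∀ e, (u e : ℝ → ℂ) =ᵐ[Γ.edgeMeasure e] sol C S (F (e, false)) (F' (e, false)) (f e) := by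
  obtain ⟨φ, dφ, hφ⟩ := hu
  have key : ∀ e, ∀ x ∈ Icc 0 (Γ.len e),
      φ e x = sol C S (φ e 0) (dφ e 0) (f e) x ∧
      dφ e x = solDeriv lam C S (φ e 0) (dφ e 0) (f e) x := by
    intro e
    obtain ⟨a1, a2, a3, -⟩ := hφ e
    have hl := Γ.len_pos e
    have cont : ∀ {p q : ℝ → ℂ}, IntervalIntegrable q volume 0 (Γ.len e) →
        (∀ x ∈ Icc 0 (Γ.len e), p x = p 0 + ∫ t in (0 : ℝ)..x, q t) →
        ContinuousOn p (Icc 0 (Γ.len e)) := by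
      intro p q hq hp
      have := intervalIntegral.continuousOn_primitive_interval' hq left_mem_uIcc
      rw [uIcc_of_le hl.le] at this
      exact (continuousOn_const.add this).congr hp
    have iw := Γ.integrable_edge (-(f + (lam : ℂ) • u)) e
    have id := integrable_deriv hl iw a3
    refine SturmLiouville.eq_sol h hl.le (Γ.integrable_edge f e) a2 (fun x hx => ?_) (cont id a2)
      (cont iw a3)
    rw [a3 x hx]
    congr 1
    refine integral_congr_edge ?_ hx
    refine (coeFn_eq_ae f u e).trans ?_
    filter_upwards [a1] with t ht
    rw [ht]
  constructor
  · intro e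
    obtain ⟨-, -, -, b1, b2, b3, b4⟩ := hφ e
    have := key e _ (right_mem_Icc.2 (Γ.len_pos e).le)
    rw [b1, b2, b3, b4]
    exact ⟨this.1, by rw [this.2]⟩
  · intro e
    obtain ⟨a1, -, -, b1, -, b3, -⟩ := hφ e
    rw [b1, b3]
    refine a1.trans ?_
    filter_upwards [ae_restrict_mem measurableSet_Ioc] with x hx
    exact (key e x (Ioc_subset_Icc_self hx)).1

/-- A zero element of `Lp` has a representative that vanishes only almost everywhere, which is still
enough to kill the Duhamel integrals at every point. -/
theorem sol_zero_ae {l : ℝ} (g : Lp ℂ 2 (volume.restrict (Ioc 0 l))) (hg : g = 0) {x : ℝ}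
    (hx : x ∈ Icc 0 l) (a b : ℂ) : sol C S a b g x = a * C x + b * S x ∧
      solDeriv lam C S a b g x = -lam * a * S x + b * C x := by
  have h0 : (g : ℝ → ℂ) =ᵐ[volume.restrict (Ioc 0 l)] 0 := by
    rw [hg]; exact Lp.coeFn_zero _ _ _
  have hz : ∀ c : ℝ → ℝ, ∫ t in (0 : ℝ)..x, (c t : ℂ) * g t = 0 := by
    intro c
    rw [integral_congr_edge (w' := fun _ => 0) _ hx]
    · simp
    · filter_upwards [h0] with t ht
      simp [ht]
  simp [sol, solDeriv, duhamel, duhamelDeriv, hz]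

/-- A homogeneous solution with zero boundary data vanishes. -/
theorem IsH2.eq_zero_of_data (h : IsFundamental lam C S) {u : Γ.L2} {F F' : E × Bool → ℂ}
    (hu : Γ.IsH2 u (-(0 + (lam : ℂ) • u)) F F') (h0 : ∀ e, F (e, false) = 0)
    (h1 : ∀ e, F' (e, false) = 0) : u = 0 := by
  have k : ∀ e, u e = 0 := fun e => by
    refine Lp.ext (((hu.eq_sol h).2 e).trans ?_)
    refine EventuallyEq.trans ?_ (Lp.coeFn_zero ℂ 2 (Γ.edgeMeasure e)).symm
    filter_upwards [ae_restrict_mem measurableSet_Ioc] with x hx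
    refine ((sol_zero_ae (lam := lam) _ rfl (Ioc_subset_Icc_self hx) _ _).1).trans ?_
    rw [h0, h1]
    simp
  exact lp.ext (funext k)

/-- Square summable solution data belong to an `H²` solution. -/
theorem exists_isH2_of_isSolutionData (h : IsFundamental lam C S) {m : ℝ}
    (hm : ∀ e, Γ.len e ≤ m) : ∃ K : NNReal, ∀ (f : Γ.L2) (F F' : E × Bool → ℂ),
      Γ.IsSolutionData lam C S f F F' →
      ∑' e, (‖F (e, false)‖ₑ ^ 2 + ‖F' (e, false)‖ₑ ^ 2) ≠ ⊤ →
      ∃ u : Γ.L2, Γ.IsH2 u (-(f + (lam : ℂ) • u)) F F' ∧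
        ‖u‖ₑ ^ 2 ≤ K * (∑' e, (‖F (e, false)‖ₑ ^ 2 + ‖F' (e, false)‖ₑ ^ 2) + ‖f‖ₑ ^ 2) := by
  obtain ⟨K, hK0, hK⟩ := exists_Lp_sol h m
  lift K to NNReal using hK0.le
  refine ⟨4 * K ^ 2, fun f F F' hF hfin => ?_⟩
  choose u hu hub using fun e => hK (Γ.len e) (Γ.len_pos e) (hm e) (f e) (F (e, false))
    (F' (e, false))
  -- The constant does not depend on e, because the lengths are bounded by m; this allows summation
  -- over the edges.
  have hb : ∀ e, ‖u e‖ₑ ^ 2 ≤ ((4 * K ^ 2 : NNReal) : ENNReal) *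
      (‖F (e, false)‖ₑ ^ 2 + ‖F' (e, false)‖ₑ ^ 2 + ‖f e‖ₑ ^ 2) :=
    fun e => enorm_sq_le_of_norm_le (hub e)
  have hsum : ∑' e, ‖u e‖ₑ ^ 2 ≤ ((4 * K ^ 2 : NNReal) : ENNReal) *
      (∑' e, (‖F (e, false)‖ₑ ^ 2 + ‖F' (e, false)‖ₑ ^ 2) + ‖f‖ₑ ^ 2) := by
    rw [lp.enorm_sq_eq_tsum f, ← ENNReal.tsum_add, ← ENNReal.tsum_mul_left]
    exact ENNReal.tsum_le_tsum hb
  have hne : ∑' e, ‖u e‖ₑ ^ 2 ≠ ⊤ := by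
    refine ne_top_of_le_ne_top ?_ hsum
    exact ENNReal.mul_ne_top ENNReal.coe_ne_top
      (ENNReal.add_ne_top.2 ⟨hfin, ENNReal.pow_ne_top enorm_ne_top⟩)
  refine ⟨⟨u, memℓp_two_of_tsum_ne_top hne⟩, ?_, ?_⟩
  · refine ⟨fun e => sol C S (F (e, false)) (F' (e, false)) (f e),
      fun e => solDeriv lam C S (F (e, false)) (F' (e, false)) (f e), fun e => ?_⟩
    have gx : ∀ x ∈ Icc 0 (Γ.len e), IntervalIntegrable (f e) volume 0 x := fun x hx =>
      (Γ.integrable_edge f e).mono_set (by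
        rw [uIcc_of_le hx.1, uIcc_of_le (Γ.len_pos e).le]
        exact Icc_subset_Icc_right hx.2)
    refine ⟨hu e, fun x hx => ?_, fun x hx => ?_, ?_, (hF e).1, ?_, (hF e).2⟩
    · refine (sol_eq_integral h (gx x hx) _ _).trans ?_
      congr 1
      exact (sol_zero h _ _).symm
    · refine (solDeriv_eq_integral h (gx x hx) _ _).trans ?_
      congr 1
      · exact (solDeriv_zero h _ _).symm
      refine integral_congr_edge (l := Γ.len e) ?_ hx
      refine EventuallyEq.trans ?_ (coeFn_eq_ae f _ e).symm
      filter_upwards [hu e] with t ht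
      rw [← ht]
    · exact (sol_zero h _ _).symm
    · exact (solDeriv_zero h _ _).symm
  · rw [lp.enorm_sq_eq_tsum]
    exact hsum

end MetricGraph

namespace MetricGraph

open SturmLiouville

variable {V E : Type*} {Γ : MetricGraph V E} {lam : ℝ} {C S : ℝ → ℝ}

/-! ### Hamiltonians and boundary data -/

theorem mem_hamiltonianGraph_iff (L : ∀ v, Γ.VertexCondition v) (u w : Γ.L2) :
    (u, w) ∈ Γ.hamiltonianGraph L ↔
      ∃ h : u ∈ (Γ.hamiltonian L).domain, Γ.hamiltonian L ⟨u, h⟩ = w := by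
  rw [← graph_hamiltonian, LinearPMap.mem_graph_iff]
  constructor
  · rintro ⟨y, rfl, rfl⟩
    exact ⟨y.2, rfl⟩
  · rintro ⟨h, rfl⟩
    exact ⟨⟨u, h⟩, rfl, rfl⟩

/-- Identifies given boundary data of a function with those provided by its membership in the domain
of the Hamiltonian. -/
theorem IsH2.unique {u w w' : Γ.L2} {F F' G G' : E × Bool → ℂ} (h : Γ.IsH2 u w F F')
    (h' : Γ.IsH2 u w' G G') : w = w' ∧ F = G ∧ F' = G' := by
  have := h.add (h'.smul (-1))
  simp only [neg_smul, one_smul, ← sub_eq_add_neg, sub_self] at this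
  obtain ⟨h1, h2, h3⟩ := this.eq_zero
  exact ⟨sub_eq_zero.1 h1, sub_eq_zero.1 h2, sub_eq_zero.1 h3⟩

/-- The boundary data of the solutions of `-u'' = lam u`. -/
def homData (Γ : MetricGraph V E) (lam : ℝ) (C S : ℝ → ℝ) :
    Submodule ℂ ((E × Bool → ℂ) × (E × Bool → ℂ)) where
  carrier := {p | ∀ e, p.1 (e, true) = p.1 (e, false) * C (Γ.len e) + p.2 (e, false) * S (Γ.len e) ∧
    p.2 (e, true) = -(-lam * p.1 (e, false) * S (Γ.len e) + p.2 (e, false) * C (Γ.len e))}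
  zero_mem' := by simp
  add_mem' := by
    intro p q hp hq e
    simp only [Prod.fst_add, Prod.snd_add, Pi.add_apply, (hp e).1, (hp e).2, (hq e).1, (hq e).2]
    constructor <;> ring
  smul_mem' := by
    intro c p hp e
    simp only [Prod.smul_fst, Prod.smul_snd, Pi.smul_apply, smul_eq_mul, (hp e).1, (hp e).2]
    constructor <;> ring

/-- The boundary data that satisfy given vertex conditions. -/
def condData (Γ : MetricGraph V E) (L : ∀ v, Γ.VertexCondition v) :
    Submodule ℂ ((E × Bool → ℂ) × (E × Bool → ℂ)) where
  carrier := {p | ∀ v, ((fun d : Γ.Ends v => p.1 d), (fun d : Γ.Ends v => p.2 d)) ∈ L v}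
  zero_mem' := fun v => (L v).zero_mem
  add_mem' := fun hp hq v => (L v).add_mem (hp v) (hq v)
  smul_mem' := fun c _ hp v => (L v).smul_mem c (hp v)

/-- The boundary data of the solution of `-u'' = lam u + g` with zero initial data on each edge. -/
def partData (Γ : MetricGraph V E) (lam : ℝ) (C S : ℝ → ℝ) (g : E → ℝ → ℂ) :
    (E × Bool → ℂ) × (E × Bool → ℂ) :=
  (fun d => if d.2 then sol C S 0 0 (g d.1) (Γ.len d.1) else 0,
    fun d => if d.2 then -solDeriv lam C S 0 0 (g d.1) (Γ.len d.1) else 0)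

theorem isSolutionData_zero_iff {F F' : E × Bool → ℂ} :
    Γ.IsSolutionData lam C S 0 F F' ↔ (F, F') ∈ Γ.homData lam C S := by
  refine forall_congr' fun e => ?_
  have h := fun a b => sol_zero_ae (lam := lam) (C := C) (S := S) ((0 : Γ.L2) e) rfl
    (right_mem_Icc.2 (Γ.len_pos e).le) a b
  rw [(h _ _).1, (h _ _).2]

/-! ### The boundary form and its nondegeneracy -/

section Form

variable {ι : Type*} [Fintype ι]

/-- The boundary form of `-d²/dx²`. -/
def bdryForm (p q : (ι → ℂ) × (ι → ℂ)) : ℂ := ∑ d, (p.2 d * conj (q.1 d) - p.1 d * conj (q.2 d))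

/-- The boundary form is nondegenerate: only the whole space has zero orthogonal complement. -/
theorem eq_top_of_bdryForm_orthogonal (W : Submodule ℂ ((ι → ℂ) × (ι → ℂ)))
    (h : ∀ p, (∀ q ∈ W, bdryForm p q = 0) → p = 0) : W = ⊤ := by
  classical
  by_contra hW
  obtain ⟨f, hf0, hf⟩ := Submodule.exists_le_ker_of_lt_top W (lt_top_iff_ne_top.2 hW)
  have hexp : ∀ q : (ι → ℂ) × (ι → ℂ), f q = ∑ d, (q.1 d * f (Pi.single d 1, 0) +
      q.2 d * f (0, Pi.single d 1)) := by
    intro q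
    have h1 := LinearMap.pi_apply_eq_sum_univ (f.comp (LinearMap.inl ℂ (ι → ℂ) (ι → ℂ))) q.1
    have h2 := LinearMap.pi_apply_eq_sum_univ (f.comp (LinearMap.inr ℂ (ι → ℂ) (ι → ℂ))) q.2
    have e : q = LinearMap.inl ℂ (ι → ℂ) (ι → ℂ) q.1 + LinearMap.inr ℂ (ι → ℂ) (ι → ℂ) q.2 := by
      ext <;> simp
    have hs : ∀ d : ι, (fun j => if d = j then (1 : ℂ) else 0) = Pi.single d 1 := fun d => by
      funext j; simp [Pi.single_apply, eq_comm]
    simp only [LinearMap.comp_apply, hs, smul_eq_mul, LinearMap.inl_apply,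
      LinearMap.inr_apply] at h1 h2
    rw [Finset.sum_add_distrib, ← h1, ← h2, ← map_add]
    simp
  -- This vector p represents f: `bdryForm p q` is the conjugate of f q. So p is orthogonal to W,
  -- hence zero, and f = 0.
  have key := h (fun d => -conj (f (0, Pi.single d 1)), fun d => conj (f (Pi.single d 1, 0))) (by
    intro q hq
    have h0 : f q = 0 := hf hq
    rw [hexp] at h0
    have := congrArg conj h0
    rw [map_zero, map_sum] at this
    rw [bdryForm, ← this]
    refine Finset.sum_congr rfl fun d _ => ?_
    simp only [map_add, map_mul]
    ring)
  apply hf0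
  ext1
  · ext d
    have := congrFun (congrArg Prod.snd key) d
    simpa using this
  · ext d
    have := congrFun (congrArg Prod.fst key) d
    simpa using this

end Form

/-- For the converse inclusion, the test data (0, e_d - e_d') detect continuity and (1, 0) detects
the flux. -/
theorem neumann_isSelfAdjoint (Γ : MetricGraph V E) (v : V) : (Γ.neumann v).IsSelfAdjoint := by
  classical
  intro p
  constructor
  · rintro ⟨hp, hp'⟩ q ⟨hq, hq'⟩
    rcases isEmpty_or_nonempty (Γ.Ends v) with h | ⟨⟨d₀⟩⟩
    · simp
    · have : ∀ d, p.2 d * conj (q.1 d) - p.1 d * conj (q.2 d) =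
          p.2 d * conj (q.1 d₀) - p.1 d₀ * conj (q.2 d) := fun d => by
        rw [hp d d₀, hq d d₀]
      simp only [this]
      rw [Finset.sum_sub_distrib, ← Finset.sum_mul, ← Finset.mul_sum, ← map_sum, hp', hq']
      simp
  · intro h
    constructor
    · intro d d'
      have := h (0, Pi.single d 1 - Pi.single d' 1) ⟨by simp, by simp⟩
      simp only [Pi.zero_apply, map_zero, mul_zero, zero_sub, Pi.sub_apply, map_sub, mul_sub,
        Finset.sum_neg_distrib, Finset.sum_sub_distrib, Pi.single_apply] at this
      simp only [apply_ite conj, map_one, map_zero, mul_ite,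
        mul_one, mul_zero, Finset.sum_ite_eq', Finset.mem_univ, if_true] at this
      linear_combination -this
    · have := h (1, 0) ⟨by simp, by simp⟩
      simpa using this

/-! ### Lagrangian subspaces of boundary data on a finite graph -/

section Finite

variable [Fintype E]

theorem sum_ends [Fintype V] (Γ : MetricGraph V E) (f : E × Bool → ℂ) :
    ∑ d, f d = ∑ v, ∑ d : Γ.Ends v, f d := by
  classical
  rw [← (Equiv.sigmaFiberEquiv Γ.endpt).sum_comp, Fintype.sum_sigma]
  refine Finset.sum_congr rfl fun v _ => ?_
  exact Fintype.sum_equiv (Equiv.refl _) _ _ fun _ => rfl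

/-- Green's identity: lam, C and S are real and the transfer matrix has determinant one, so the two
ends of every edge cancel. -/
theorem bdryForm_homData (h : IsFundamental lam C S) {p q : (E × Bool → ℂ) × (E × Bool → ℂ)}
    (hp : p ∈ Γ.homData lam C S) (hq : q ∈ Γ.homData lam C S) : bdryForm p q = 0 := by
  rw [bdryForm, Fintype.sum_prod_type]
  refine Finset.sum_eq_zero fun e _ => ?_
  rw [Fintype.sum_bool, (hp e).1, (hp e).2, (hq e).1, (hq e).2]
  simp only [map_add, map_mul, map_neg, Complex.conj_ofReal]
  have w := h.wronskian' (Γ.len e)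
  linear_combination (p.1 (e, false) * conj (q.2 (e, false)) -
    p.2 (e, false) * conj (q.1 (e, false))) * w

/-- Solutions supported on one edge, with initial data (1, 0) and (0, 1), give two linear equations
for the data at the far end; the Wronskian identity solves them. -/
theorem mem_homData_of_orthogonal (h : IsFundamental lam C S)
    {p : (E × Bool → ℂ) × (E × Bool → ℂ)}
    (hp : ∀ q ∈ Γ.homData lam C S, bdryForm p q = 0) : p ∈ Γ.homData lam C S := by
  classical
  intro e
  have key : ∀ a b : ℝ, p.2 (e, false) * a - p.1 (e, false) * b +
      (p.2 (e, true) * (a * C (Γ.len e) + b * S (Γ.len e)) +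
      p.1 (e, true) * (-lam * a * S (Γ.len e) + b * C (Γ.len e))) = 0 := by
    intro a b
    have := hp (fun d => if d.1 = e then
        (if d.2 then a * C (Γ.len e) + b * S (Γ.len e) else (a : ℂ)) else 0,
      fun d => if d.1 = e then
        (if d.2 then -(-lam * a * S (Γ.len e) + b * C (Γ.len e)) else (b : ℂ)) else 0) (by
      intro e'
      by_cases he : e' = e
      · subst he; simp
      · simp [he])
    rw [bdryForm, Fintype.sum_prod_type, Finset.sum_eq_single e] at this
    · rw [Fintype.sum_bool] at this
      simp only [if_true, Bool.false_eq_true, if_false, map_add, map_mul, map_neg,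
        Complex.conj_ofReal] at this
      rw [← this]; ring
    · intro e' _ he
      simp [he]
    · simp
  have k1 := key 1 0
  have k2 := key 0 1
  push_cast at k1 k2
  have w := h.wronskian' (Γ.len e)
  constructor
  · linear_combination (-p.1 (e, true)) * w + C (Γ.len e) * k2 - S (Γ.len e) * k1
  · linear_combination (-p.2 (e, true)) * w + C (Γ.len e) * k1 + lam * S (Γ.len e) * k2

/-- An element of L v extended by zero to the other ends is an admissible test vector, so
orthogonality localizes to each vertex, where L v is Lagrangian. -/
theorem mem_condData_of_orthogonal [Fintype V] {L : ∀ v, Γ.VertexCondition v}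
    (hL : ∀ v, (L v).IsSelfAdjoint) {p : (E × Bool → ℂ) × (E × Bool → ℂ)}
    (hp : ∀ q ∈ Γ.condData L, bdryForm p q = 0) : p ∈ Γ.condData L := by
  classical
  intro v
  rw [hL v]
  intro q hq
  have := hp (fun d => if h : Γ.endpt d = v then q.1 ⟨d, h⟩ else 0,
    fun d => if h : Γ.endpt d = v then q.2 ⟨d, h⟩ else 0) (by
    intro v'
    by_cases hv : v' = v
    · subst hv
      convert hq using 1
      ext d
      · simp [d.2]
      · simp [d.2]
    · convert (L v').zero_mem using 1
      ext d
      · simp [d.2, hv]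
      · simp [d.2, hv])
  rw [bdryForm, Γ.sum_ends, Finset.sum_eq_single v] at this
  · rw [← this]
    refine Finset.sum_congr rfl fun d _ => ?_
    simp [d.2]
  · intro v' _ hv
    refine Finset.sum_eq_zero fun d _ => ?_
    simp [d.2, hv]
  · simp

/-- If no nonzero solution satisfies the self-adjoint conditions `L`, then all boundary data can be
corrected by those of a solution to satisfy `L`. -/
theorem exists_projection_condData [Fintype V] (h : IsFundamental lam C S)
    {L : ∀ v, Γ.VertexCondition v} (hL : ∀ v, (L v).IsSelfAdjoint)
    (hinj : ∀ p ∈ Γ.homData lam C S, p ∈ Γ.condData L → p = 0) :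
    ∃ Q : ((E × Bool → ℂ) × (E × Bool → ℂ)) →ₗ[ℂ] ((E × Bool → ℂ) × (E × Bool → ℂ)),
      ∀ p, Q p ∈ Γ.condData L ∧ Q p - p ∈ Γ.homData lam C S := by
  -- Each subspace contains its own orthogonal complement, so a vector orthogonal to the sum lies in
  -- both and is zero by `hinj`. With nondegeneracy the two are complementary, and Q projects onto
  -- `condData` along `homData`.
  have htop : Γ.condData L ⊔ Γ.homData lam C S = ⊤ := by
    refine eq_top_of_bdryForm_orthogonal _ fun p hp => hinj p ?_ ?_
    · exact mem_homData_of_orthogonal h fun q hq => hp q (Submodule.mem_sup_right hq)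
    · exact mem_condData_of_orthogonal hL fun q hq => hp q (Submodule.mem_sup_left hq)
  have hbot : Γ.condData L ⊓ Γ.homData lam C S = ⊥ := by
    rw [eq_bot_iff]
    rintro p ⟨h1, h2⟩
    exact hinj p h2 h1
  have hc : IsCompl (Γ.condData L) (Γ.homData lam C S) :=
    ⟨disjoint_iff.2 hbot, codisjoint_iff.2 htop⟩
  refine ⟨(Γ.condData L).projection _ hc, fun p => ⟨Submodule.projection_apply_mem hc p, ?_⟩⟩
  have := Submodule.projection_add_projection_eq_self hc p
  have h2 : (Γ.condData L).projection _ hc p - p = -(Γ.homData lam C S).projection _ hc.symm p := by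
    nth_rw 2 [← this]
    abel
  rw [h2]
  exact (Γ.homData lam C S).neg_mem (Submodule.projection_apply_mem hc.symm p)

end Finite

end MetricGraph

namespace MetricGraph

open SturmLiouville

variable {V E : Type*} {Γ : MetricGraph V E} {lam : ℝ} {C S : ℝ → ℝ}

/-! ### The decoration at a simple Dirichlet eigenvalue -/

open Classical in
/-- The conditions `L` with the Neumann condition at `v₁`. -/
def neumannConditions (Γ : MetricGraph V E) (v₁ : V) (L : ∀ a, Γ.VertexCondition a) (a : V) :
    Γ.VertexCondition a :=
  if a = v₁ then Γ.neumann a else L a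

theorem neumannConditions_isSelfAdjoint {v₁ : V} {L : ∀ a, Γ.VertexCondition a}
    (hL : ∀ a, a ≠ v₁ → (L a).IsSelfAdjoint) (a : V) :
    (Γ.neumannConditions v₁ L a).IsSelfAdjoint := by
  unfold neumannConditions
  split_ifs with h
  · exact Γ.neumann_isSelfAdjoint a
  · exact hL a h

theorem mem_eigenspace_hamiltonian {L : ∀ v, Γ.VertexCondition v} {z : ℂ} {u : Γ.L2} :
    u ∈ UnboundedOp.eigenspace (Γ.hamiltonian L) z ↔ (u, z • u) ∈ Γ.hamiltonianGraph L :=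
  (mem_hamiltonianGraph_iff L u (z • u)).symm

/-- The boundary data of an eigenfunction. -/
theorem data_of_mem_eigenspace (h : IsFundamental lam C S) {L : ∀ v, Γ.VertexCondition v}
    {u u'' : Γ.L2} {F F' : E × Bool → ℂ}
    (hu : u ∈ UnboundedOp.eigenspace (Γ.hamiltonian L) (lam : ℂ)) (hF : Γ.IsH2 u u'' F F') :
    (F, F') ∈ Γ.homData lam C S ∧ (F, F') ∈ Γ.condData L := by
  obtain ⟨G, G', hG, hL⟩ := mem_eigenspace_hamiltonian.1 hu
  obtain ⟨-, rfl, rfl⟩ := hF.unique hG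
  refine ⟨?_, hL⟩
  have : Γ.IsH2 u (-(0 + (lam : ℂ) • u)) F F' := by rwa [zero_add]
  exact isSolutionData_zero_iff.1 (this.eq_sol h).1

/-- Homogeneous data that satisfy the conditions are those of an eigenfunction. -/
theorem exists_mem_eigenspace [Fintype E] (h : IsFundamental lam C S)
    {L : ∀ v, Γ.VertexCondition v} {p : (E × Bool → ℂ) × (E × Bool → ℂ)}
    (hp : p ∈ Γ.homData lam C S) (hpL : p ∈ Γ.condData L) :
    ∃ u ∈ UnboundedOp.eigenspace (Γ.hamiltonian L) (lam : ℂ),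
      Γ.IsH2 u (-((lam : ℂ) • u)) p.1 p.2 := by
  obtain ⟨K, hK⟩ := exists_isH2_of_isSolutionData (Γ := Γ) h (m := ∑ e, Γ.len e)
    (fun e => Finset.single_le_sum (fun e _ => (Γ.len_pos e).le) (Finset.mem_univ e))
  obtain ⟨u, hu, -⟩ := hK 0 p.1 p.2 (isSolutionData_zero_iff.2 hp) (by
    rw [tsum_fintype]
    refine ENNReal.sum_ne_top.2 fun e _ => ?_
    exact ENNReal.add_ne_top.2 ⟨ENNReal.pow_ne_top enorm_ne_top, ENNReal.pow_ne_top enorm_ne_top⟩)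
  rw [zero_add] at hu
  exact ⟨u, mem_eigenspace_hamiltonian.2 ⟨p.1, p.2, hu, hpL⟩, hu⟩

/-- At a simple Dirichlet eigenvalue with nonzero flux, every solution that is continuous at the
root is a multiple of the eigenfunction. -/
theorem exists_eq_smul_of_continuous_at_root [Fintype V] [Fintype E] (h : IsFundamental lam C S)
    {v₁ : V} {L : ∀ a, Γ.VertexCondition a} (hL : ∀ a, a ≠ v₁ → (L a).IsSelfAdjoint)
    (hsimple : UnboundedOp.IsSimpleEigenvalue
      (Γ.hamiltonian (Γ.decorationConditions v₁ L)) (lam : ℂ))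
    {ψ ψ'' : Γ.L2} {F F' : E × Bool → ℂ}
    (hψ : ψ ∈ UnboundedOp.eigenspace (Γ.hamiltonian (Γ.decorationConditions v₁ L)) (lam : ℂ))
    (hF : Γ.IsH2 ψ ψ'' F F') (hne : ∑ d : Γ.Ends v₁, F' d ≠ 0)
    {p : (E × Bool → ℂ) × (E × Bool → ℂ)} (hp : p ∈ Γ.homData lam C S)
    (hpL : ∀ a, a ≠ v₁ → ((fun d : Γ.Ends a => p.1 d), (fun d : Γ.Ends a => p.2 d)) ∈ L a)
    {c : ℂ} (hc : ∀ d : Γ.Ends v₁, p.1 d = c) : ∃ t : ℂ, p = t • (F, F') := by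
  obtain ⟨hψ1, hψ2⟩ := data_of_mem_eigenspace h hψ hF
  have hd : ∀ a, a ≠ v₁ → Γ.decorationConditions v₁ L a = L a := fun a ha => if_neg ha
  have hd₁ : Γ.decorationConditions v₁ L v₁ = Γ.dirichlet v₁ := if_pos rfl
  have hψ0 : ∀ d : Γ.Ends v₁, F d = 0 := by
    have := hψ2 v₁
    rw [hd₁] at this
    exact fun d => congrFun this d
  -- Green's identity against ψ: away from v₁ both data lie in the same Lagrangian subspace, and at
  -- v₁, where ψ vanishes, what remains is -c times the conjugate of the flux.
  have hc0 : c = 0 := by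
    have hb := bdryForm_homData h hp hψ1
    rw [bdryForm, Γ.sum_ends, Finset.sum_eq_single v₁] at hb
    · simp only [hψ0, hc, map_zero, mul_zero, zero_sub, Finset.sum_neg_distrib] at hb
      rw [← Finset.mul_sum, ← map_sum, neg_eq_zero, mul_eq_zero] at hb
      rcases hb with hb | hb
      · exact hb
      · exact absurd ((map_eq_zero _).1 hb) hne
    · intro a _ ha
      have h1 := hψ2 a
      rw [hd a ha] at h1
      exact (hL a ha _).1 (hpL a ha) _ h1
    · simp
  subst hc0
  have hpD : p ∈ Γ.condData (Γ.decorationConditions v₁ L) := by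
    intro a
    by_cases ha : a = v₁
    · subst ha
      rw [hd₁]
      exact funext hc
    · rw [hd a ha]
      exact hpL a ha
  obtain ⟨u, hu, hu2⟩ := exists_mem_eigenspace h hp hpD
  -- ψ is nonzero because its flux is, so it spans the one-dimensional eigenspace.
  have hψne : (⟨ψ, hψ⟩ : UnboundedOp.eigenspace
      (Γ.hamiltonian (Γ.decorationConditions v₁ L)) (lam : ℂ)) ≠ 0 := by
    intro h0
    have h0' : ψ = 0 := congrArg Subtype.val h0
    subst h0'
    apply hne
    rw [hF.eq_zero.2.2]
    simp
  obtain ⟨t, ht⟩ := (finrank_eq_one_iff_of_nonzero' _ hψne).1 hsimple ⟨u, hu⟩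
  have ht' : t • ψ = u := congrArg Subtype.val ht
  subst ht'
  obtain ⟨-, h1, h2⟩ := hu2.unique (hF.smul t)
  exact ⟨t, Prod.ext h1 h2⟩

/-- At a simple Dirichlet eigenvalue with nonzero flux, all boundary data can be corrected by those
of a solution to satisfy the Neumann condition at the root. -/
theorem exists_projection_neumannConditions [Fintype V] [Fintype E] (h : IsFundamental lam C S)
    {v₁ : V} {L : ∀ a, Γ.VertexCondition a} (hL : ∀ a, a ≠ v₁ → (L a).IsSelfAdjoint)
    (hsimple : UnboundedOp.IsSimpleEigenvalue
      (Γ.hamiltonian (Γ.decorationConditions v₁ L)) (lam : ℂ))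
    {ψ ψ'' : Γ.L2} {F F' : E × Bool → ℂ}
    (hψ : ψ ∈ UnboundedOp.eigenspace (Γ.hamiltonian (Γ.decorationConditions v₁ L)) (lam : ℂ))
    (hF : Γ.IsH2 ψ ψ'' F F') (hne : ∑ d : Γ.Ends v₁, F' d ≠ 0) :
    ∃ Q : ((E × Bool → ℂ) × (E × Bool → ℂ)) →ₗ[ℂ] ((E × Bool → ℂ) × (E × Bool → ℂ)),
      ∀ p, Q p ∈ Γ.condData (Γ.neumannConditions v₁ L) ∧ Q p - p ∈ Γ.homData lam C S := by
  refine exists_projection_condData h (neumannConditions_isSelfAdjoint hL) fun p hp hpL => ?_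
  have hn : ((fun d : Γ.Ends v₁ => p.1 d), (fun d : Γ.Ends v₁ => p.2 d)) ∈ Γ.neumann v₁ := by
    have := hpL v₁
    rwa [neumannConditions, if_pos rfl] at this
  have hne' : Nonempty (Γ.Ends v₁) := by
    by_contra hE
    rw [not_nonempty_iff] at hE
    exact hne (by simp)
  obtain ⟨d₀⟩ := hne'
  obtain ⟨t, rfl⟩ := exists_eq_smul_of_continuous_at_root h hL hsimple hψ hF hne hp
    (fun a ha => by
      have := hpL a
      rwa [neumannConditions, if_neg ha] at this) (fun d => hn.1 d d₀)
  -- The zero flux part of the Neumann condition for tψ forces t = 0.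
  have h0 : t * ∑ d : Γ.Ends v₁, F' d = 0 := by
    rw [Finset.mul_sum]
    exact hn.2
  rw [(mul_eq_zero.1 h0).resolve_right hne, zero_smul]

end MetricGraph

/-! ### The Dirichlet problem on an edge -/

namespace SturmLiouville

variable {lam : ℝ} {C S : ℝ → ℝ}

/-- The initial derivative of the solution of `-u'' = lam u + g` with boundary values `a, a'`. -/
def dirichletDeriv (C S : ℝ → ℝ) (l : ℝ) (a a' : ℂ) (g : ℝ → ℂ) : ℂ :=
  (a' - sol C S a 0 g l) / S l

/-- The value at l is affine in the initial derivative with slope S l. -/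
theorem sol_dirichletDeriv {l : ℝ} (hl : S l ≠ 0) (a a' : ℂ) (g : ℝ → ℂ) :
    sol C S a (dirichletDeriv C S l a a' g) g l = a' := by
  have : (S l : ℂ) ≠ 0 := by exact_mod_cast hl
  rw [sol_eq_add, dirichletDeriv, div_mul_cancel₀ _ this, sol_eq_add a 0]
  ring

/-- Uniform bounds for the derivatives at the ends of the solution of the Dirichlet problem. -/
theorem exists_bound_dirichletDeriv (h : IsFundamental lam C S) (m M : ℝ) : ∃ K : NNReal,
    ∀ l, 0 < l → l ≤ m → |(S l)⁻¹| ≤ M →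
      ∀ (g : Lp ℂ 2 (volume.restrict (Ioc 0 l))) (a a' : ℂ),
        ‖dirichletDeriv C S l a a' g‖ₑ ^ 2 ≤ K * (‖a‖ₑ ^ 2 + ‖a'‖ₑ ^ 2 + ‖g‖ₑ ^ 2) ∧
        ‖solDeriv lam C S a (dirichletDeriv C S l a a' g) g l‖ₑ ^ 2 ≤
          K * (‖a‖ₑ ^ 2 + ‖a'‖ₑ ^ 2 + ‖g‖ₑ ^ 2) := by
  obtain ⟨K, hK0, hK⟩ := exists_bound_sol h m
  set M' := max M 0
  have hM' : 0 ≤ M' := le_max_right _ _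
  -- A bounds the initial derivative: a numerator of size 1 + K divided by S l. Feeding this back
  -- into the solution bound gives K(1 + A) for the final derivative, and the sum B below dominates
  -- both.
  set A : ℝ := M' * (1 + K) with hA
  have hA0 : 0 ≤ A := by positivity
  lift A to NNReal using hA0 with A' hA'
  have hB0 : 0 ≤ K * (1 + A') + A' := by positivity
  lift K * (1 + A') + A' to NNReal using hB0 with B hB
  refine ⟨4 * B ^ 2, fun l hl hlm hS g a a' => ?_⟩
  have hb : ‖dirichletDeriv C S l a a' g‖ ≤ A' * (‖a‖ + ‖a'‖ + ‖g‖) := by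
    have h1 := (hK l hl hlm g a 0 l (right_mem_Icc.2 hl.le)).1
    rw [norm_zero, add_zero] at h1
    have h2 : ‖a' - sol C S a 0 g l‖ ≤ (1 + K) * (‖a‖ + ‖a'‖ + ‖g‖) := by
      refine (norm_sub_le _ _).trans ?_
      have : 0 ≤ ‖a‖ + ‖g‖ + K * ‖a'‖ := by positivity
      linarith
    rw [dirichletDeriv, div_eq_mul_inv, norm_mul, mul_comm, hA, mul_assoc]
    refine mul_le_mul ?_ h2 (norm_nonneg _) hM'
    rw [← Complex.ofReal_inv, Complex.norm_real]
    exact hS.trans (le_max_left _ _)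
  have hT : 0 ≤ ‖a‖ + ‖a'‖ + ‖g‖ := by positivity
  constructor
  · apply enorm_sq_le_of_norm_le
    rw [hB]
    refine hb.trans (mul_le_mul_of_nonneg_right ?_ hT)
    have : 0 ≤ K * (1 + A') := by positivity
    linarith
  · apply enorm_sq_le_of_norm_le
    rw [hB]
    refine (hK l hl hlm g a _ l (right_mem_Icc.2 hl.le)).2.trans ?_
    have h3 : ‖a‖ + ‖dirichletDeriv C S l a a' g‖ + ‖g‖ ≤
        (1 + A') * (‖a‖ + ‖a'‖ + ‖g‖) := by
      have := norm_nonneg a'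
      linarith
    refine (mul_le_mul_of_nonneg_left h3 hK0.le).trans ?_
    have : 0 ≤ A' * (‖a‖ + ‖a'‖ + ‖g‖) := by positivity
    linarith

end SturmLiouville

/-! ### Uniform estimates on edges, copies and vertices -/

namespace MetricGraph

open SturmLiouville

variable {V E : Type*} {Γ : MetricGraph V E} {lam : ℝ} {C S : ℝ → ℝ}

/-- Away from the Dirichlet spectrum, the Dirichlet problems on the edges are uniformly solvable. -/
theorem exists_bound_inv (hA : Γ.ConditionA) (hlam : lam ∉ Γ.dirichletSpectrum)
    (h : IsFundamental lam C S) (hS : ∀ l, 0 < l → S l = 0 → ∃ n : ℤ, n ≠ 0 ∧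
      lam = Real.pi ^ 2 * (n : ℝ) ^ 2 / l ^ 2) : ∃ M : ℝ, ∀ e, |(S (Γ.len e))⁻¹| ≤ M := by
  obtain ⟨l₀, m, hl₀, hlen⟩ := hA
  have hsub : closure (range Γ.len) ⊆ Icc l₀ m :=
    closure_minimal (by rintro _ ⟨e, rfl⟩; exact hlen e) isClosed_Icc
  -- A zero of S at a limit l of edge lengths would make lam = π²n²/l² a limit of the Dirichlet
  -- eigenvalues with the same n, hence a point of the closed set σ_D. So 1/S is bounded on this
  -- compact set of lengths.
  have hne : ∀ l ∈ closure (range Γ.len), S l ≠ 0 := by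
    intro l hl h0
    have hl0 : 0 < l := hl₀.trans_le (hsub hl).1
    obtain ⟨n, hn, rfl⟩ := hS l hl0 h0
    apply hlam
    have hc : ContinuousAt (fun l : ℝ => Real.pi ^ 2 * (n : ℝ) ^ 2 / l ^ 2) l :=
      continuousAt_const.div (continuousAt_id.pow 2) (by positivity)
    rw [mem_closure_iff_clusterPt] at hl
    have := hl.map hc tendsto_map
    refine mem_closure_iff_clusterPt.2 (this.mono ?_)
    rw [map_principal, principal_mono]
    rintro _ ⟨_, ⟨e, rfl⟩, rfl⟩
    exact ⟨e, n, hn, rfl⟩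
  obtain ⟨M, hM⟩ := (isCompact_Icc.of_isClosed_subset isClosed_closure
    hsub).exists_bound_of_continuousOn (h.continuous_sin.continuousOn.inv₀ hne)
  exact ⟨M, fun e => hM _ (subset_closure ⟨e, rfl⟩)⟩

theorem norm_partData_le [Fintype E] (h : IsFundamental lam C S) : ∃ K : ℝ, 0 ≤ K ∧
    ∀ g : ∀ e, Lp ℂ 2 (Γ.edgeMeasure e),
      ‖Γ.partData lam C S fun e => g e‖ ≤ K * ∑ e, ‖g e‖ := by
  obtain ⟨K, hK0, hK⟩ := exists_bound_sol h (∑ e, Γ.len e)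
  refine ⟨K, hK0.le, fun g => ?_⟩
  have hle : ∀ e, Γ.len e ≤ ∑ e, Γ.len e := fun e =>
    Finset.single_le_sum (f := Γ.len) (fun e _ => (Γ.len_pos e).le) (Finset.mem_univ e)
  have hT : 0 ≤ K * ∑ e, ‖g e‖ := by positivity
  have hg : ∀ e, K * (‖(0 : ℂ)‖ + ‖(0 : ℂ)‖ + ‖g e‖) ≤ K * ∑ e, ‖g e‖ := fun e => by
    rw [norm_zero, zero_add, zero_add]
    exact mul_le_mul_of_nonneg_left (Finset.single_le_sum (f := fun e => ‖g e‖)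
      (fun e _ => norm_nonneg _) (Finset.mem_univ e)) hK0.le
  rw [partData, Prod.norm_def]
  refine max_le ((pi_norm_le_iff_of_nonneg hT).2 ?_) ((pi_norm_le_iff_of_nonneg hT).2 ?_)
  all_goals
    rintro ⟨e, b⟩
    have := hK _ (Γ.len_pos e) (hle e) (g e) 0 0 _ (right_mem_Icc.2 (Γ.len_pos e).le)
    cases b
    · simpa using hT
  · exact this.1.trans (hg e)
  · simpa using this.2.trans (hg e)

/-- Q acts on a finite-dimensional space and is therefore bounded. The constant is independent of g,
so the same one serves every copy of the decoration. -/
theorem exists_bound_partData [Fintype E] (h : IsFundamental lam C S)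
    (Q : ((E × Bool → ℂ) × (E × Bool → ℂ)) →ₗ[ℂ] ((E × Bool → ℂ) × (E × Bool → ℂ))) :
    ∃ K : NNReal, ∀ g : ∀ e, Lp ℂ 2 (Γ.edgeMeasure e),
      ‖Q (Γ.partData lam C S fun e => g e)‖ₑ ^ 2 ≤ K * ∑ e, ‖g e‖ₑ ^ 2 := by
  obtain ⟨K, hK0, hK⟩ := norm_partData_le (Γ := Γ) h
  set T := LinearMap.toContinuousLinearMap Q
  have hB0 : 0 ≤ ‖T‖ * K := by positivity
  lift ‖T‖ * K to NNReal using hB0 with B hB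
  refine ⟨B ^ 2 * Fintype.card E, fun g => ?_⟩
  have h1 : ‖Q (Γ.partData lam C S fun e => g e)‖ ≤ B * ∑ e, ‖g e‖ := by
    rw [hB, mul_assoc]
    exact (T.le_opNorm _).trans (mul_le_mul_of_nonneg_left (hK g) (norm_nonneg _))
  have h2 : ‖Q (Γ.partData lam C S fun e => g e)‖ₑ ≤ B * ∑ e, ‖g e‖ₑ := by
    have h3 : ‖Q (Γ.partData lam C S fun e => g e)‖₊ ≤ B * ∑ e, ‖g e‖₊ := by
      rw [← NNReal.coe_le_coe]
      push_cast
      exact h1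
    have h4 := ENNReal.coe_le_coe.2 h3
    push_cast at h4
    exact h4
  calc _ ≤ (B * ∑ e, ‖g e‖ₑ) ^ 2 := by gcongr
    _ = B ^ 2 * (∑ e, ‖g e‖ₑ) ^ 2 := mul_pow _ _ _
    _ ≤ B ^ 2 * (Fintype.card E * ∑ e, ‖g e‖ₑ ^ 2) := by
        gcongr
        exact ENNReal.sum_sq_le _ _
    _ = _ := by push_cast; ring

/-- A sum over the edge ends of values at vertices. -/
theorem tsum_endpt_le {D : ℕ} (hD : ∀ v, Γ.degree v ≤ D) (x : V → ENNReal) :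
    ∑' d, x (Γ.endpt d) ≤ D * ∑' v, x v := by
  -- Grouped by vertices, each x v is counted once per end at v.
  rw [← ENNReal.tsum_fiberwise _ Γ.endpt, ← ENNReal.tsum_mul_left]
  refine ENNReal.tsum_le_tsum fun v => ?_
  have : ∀ b : Γ.endpt ⁻¹' {v}, x (Γ.endpt b) = x v := fun b => by rw [b.2]
  simp only [this]
  have h2 : ∑' _ : Γ.Ends v, x v = Γ.degree v * x v := by
    rw [tsum_fintype, Finset.sum_const, nsmul_eq_mul, Finset.card_univ, degree]
  refine (le_of_eq h2).trans ?_
  gcongr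
  exact hD v

theorem tsum_edge_endpt_le {D : ℕ} (hD : ∀ v, Γ.degree v ≤ D) (x : V → ENNReal) (b : Bool) :
    ∑' e, x (Γ.endpt (e, b)) ≤ D * ∑' v, x v :=
  (ENNReal.tsum_comp_le_tsum_of_injective (f := fun e : E => (e, b))
    (fun _ _ h => congrArg Prod.fst h) fun d => x (Γ.endpt d)).trans (tsum_endpt_le hD x)

/-- The square sum of the fluxes at the vertices. -/
theorem tsum_flux_le {D : ℕ} (hD : ∀ v, Γ.degree v ≤ D) (y : E × Bool → ℂ) :
    ∑' v, ‖∑ d : Γ.Ends v, y d‖ₑ ^ 2 ≤ D * ∑' d, ‖y d‖ₑ ^ 2 := by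
  rw [← ENNReal.tsum_fiberwise _ Γ.endpt, ← ENNReal.tsum_mul_left]
  refine ENNReal.tsum_le_tsum fun v => ?_
  calc ‖∑ d : Γ.Ends v, y d‖ₑ ^ 2 ≤ (∑ d : Γ.Ends v, ‖y d‖ₑ) ^ 2 := by
        gcongr
        exact enorm_sum_le _ _
    _ ≤ Γ.degree v * ∑ d : Γ.Ends v, ‖y d‖ₑ ^ 2 := ENNReal.sum_sq_le _ _
    _ ≤ D * ∑ d : Γ.Ends v, ‖y d‖ₑ ^ 2 := by
        gcongr
        exact hD v
    _ = D * ∑' d : Γ.Ends v, ‖y d‖ₑ ^ 2 := by rw [tsum_fintype]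

end MetricGraph

namespace MetricGraph

open SturmLiouville

variable {V₀ E₀ V₁ E₁ : Type*} {Γ₀ : MetricGraph V₀ E₀} {Γ₁ : MetricGraph V₁ E₁} {v₁ : V₁}
  {lam : ℝ} {C S : ℝ → ℝ}

/-! ### The decorated graph -/

/-- The inclusion of the edge ends at `v` in `Γ₀` into the edge ends at the root of the copy at `v`
in the decorated graph. -/
def baseEnd (Γ₀ : MetricGraph V₀ E₀) (Γ₁ : MetricGraph V₁ E₁) (v₁ : V₁) (v : V₀)
    (d : Γ₀.Ends v) : (Γ₀.decorate Γ₁ v₁).Ends (v, v₁) :=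
  ⟨(Sum.inl d.1.1, d.1.2), Prod.ext d.2 rfl⟩

theorem ends_root_cases {v : V₀} (d : (Γ₀.decorate Γ₁ v₁).Ends (v, v₁)) :
    (∃ d₀, d = Γ₀.baseEnd Γ₁ v₁ v d₀) ∨ ∃ d₁, d = Γ₀.copyEnd Γ₁ v₁ v v₁ d₁ := by
  obtain ⟨⟨e | ⟨v', e⟩, b⟩, h⟩ := d
  · exact Or.inl ⟨⟨(e, b), (Prod.mk.inj h).1⟩, rfl⟩
  · obtain ⟨h1, h2⟩ := Prod.mk.inj h
    subst h1
    exact Or.inr ⟨⟨(e, b), h2⟩, rfl⟩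

theorem sum_ends_root (v : V₀) (f : (Γ₀.decorate Γ₁ v₁).Ends (v, v₁) → ℂ) :
    ∑ d, f d = ∑ d, f (Γ₀.baseEnd Γ₁ v₁ v d) + ∑ d, f (Γ₀.copyEnd Γ₁ v₁ v v₁ d) := by
  have hb : Function.Bijective (Sum.elim (Γ₀.baseEnd Γ₁ v₁ v) (Γ₀.copyEnd Γ₁ v₁ v v₁)) := by
    constructor
    · rintro (⟨⟨e, b⟩, h⟩ | ⟨⟨e, b⟩, h⟩) (⟨⟨e', b'⟩, h'⟩ | ⟨⟨e', b'⟩, h'⟩) hd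
      · simpa [baseEnd] using hd
      · simp [baseEnd, copyEnd] at hd
      · simp [baseEnd, copyEnd] at hd
      · simpa [copyEnd] using hd
    · intro d
      rcases ends_root_cases d with ⟨d₀, rfl⟩ | ⟨d₁, rfl⟩
      · exact ⟨Sum.inl d₀, rfl⟩
      · exact ⟨Sum.inr d₁, rfl⟩
  rw [← (Equiv.ofBijective _ hb).sum_comp, Fintype.sum_sum_type]
  rfl

/-- The boundary data on the copy of `Γ₁` at `v`. -/
def copyData (v : V₀) (p : ((E₀ ⊕ V₀ × E₁) × Bool → ℂ) × ((E₀ ⊕ V₀ × E₁) × Bool → ℂ)) :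
    (E₁ × Bool → ℂ) × (E₁ × Bool → ℂ) :=
  (fun d => p.1 (Sum.inr (v, d.1), d.2), fun d => p.2 (Sum.inr (v, d.1), d.2))

/-- The conditions on the decorated graph in terms of the base graph and the copies. -/
theorem mem_condData_decorated_iff {L : ∀ a, Γ₁.VertexCondition a}
    {p : ((E₀ ⊕ V₀ × E₁) × Bool → ℂ) × ((E₀ ⊕ V₀ × E₁) × Bool → ℂ)} :
    p ∈ (Γ₀.decorate Γ₁ v₁).condData (Γ₀.decoratedConditions Γ₁ v₁ L) ↔
      (∀ v a, a ≠ v₁ → ((fun d : Γ₁.Ends a => (copyData v p).1 d),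
        (fun d : Γ₁.Ends a => (copyData v p).2 d)) ∈ L a) ∧
      ∀ v, (∃ c, (∀ d : Γ₀.Ends v, p.1 (Sum.inl d.1.1, d.1.2) = c) ∧
        ∀ d : Γ₁.Ends v₁, (copyData v p).1 d = c) ∧
        ∑ d : Γ₀.Ends v, p.2 (Sum.inl d.1.1, d.1.2) +
          ∑ d : Γ₁.Ends v₁, (copyData v p).2 d = 0 := by
  constructor
  · intro h
    refine ⟨fun v a ha => ?_, fun v => ?_⟩
    · have := h (v, a)
      rw [decoratedConditions, if_neg ha] at this
      exact this
    · have := h (v, v₁)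
      rw [decoratedConditions, if_pos rfl] at this
      obtain ⟨h1, h2⟩ := this
      refine ⟨?_, ?_⟩
      · rcases isEmpty_or_nonempty ((Γ₀.decorate Γ₁ v₁).Ends (v, v₁)) with hE | ⟨⟨d₀⟩⟩
        · exact ⟨0, fun d => hE.elim (Γ₀.baseEnd Γ₁ v₁ v d),
            fun d => hE.elim (Γ₀.copyEnd Γ₁ v₁ v v₁ d)⟩
        · exact ⟨p.1 d₀, fun d => h1 (Γ₀.baseEnd Γ₁ v₁ v d) d₀,
            fun d => h1 (Γ₀.copyEnd Γ₁ v₁ v v₁ d) d₀⟩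
      · rw [sum_ends_root] at h2
        exact h2
  · rintro ⟨h1, h2⟩ ⟨v, a⟩
    by_cases ha : a = v₁
    · subst ha
      rw [decoratedConditions, if_pos rfl]
      obtain ⟨⟨c, hc0, hc1⟩, hs⟩ := h2 v
      have hc : ∀ d : (Γ₀.decorate Γ₁ a).Ends (v, a), p.1 d = c := by
        intro d
        rcases ends_root_cases d with ⟨d₀, rfl⟩ | ⟨d₁, rfl⟩
        · exact hc0 d₀
        · exact hc1 d₁
      refine ⟨fun d d' => (hc d).trans (hc d').symm, ?_⟩
      rw [sum_ends_root]
      exact hs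
    · rw [decoratedConditions, if_neg ha]
      exact h1 v a ha

theorem copyData_mem_homData {p : ((E₀ ⊕ V₀ × E₁) × Bool → ℂ) × ((E₀ ⊕ V₀ × E₁) × Bool → ℂ)}
    (hp : p ∈ (Γ₀.decorate Γ₁ v₁).homData lam C S) (v : V₀) :
    copyData v p ∈ Γ₁.homData lam C S :=
  fun e => hp (Sum.inr (v, e))

/-- On a copy, solution data are the particular data plus homogeneous data, the form in which the
projection Q applies; on the base the explicit formula is kept for the Dirichlet problems. -/
theorem isSolutionData_decorate_iff {f : (Γ₀.decorate Γ₁ v₁).L2}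
    {p : ((E₀ ⊕ V₀ × E₁) × Bool → ℂ) × ((E₀ ⊕ V₀ × E₁) × Bool → ℂ)} :
    (Γ₀.decorate Γ₁ v₁).IsSolutionData lam C S f p.1 p.2 ↔
      (∀ e, p.1 (Sum.inl e, true) = sol C S (p.1 (Sum.inl e, false)) (p.2 (Sum.inl e, false))
          (f (Sum.inl e)) (Γ₀.len e) ∧
        p.2 (Sum.inl e, true) = -solDeriv lam C S (p.1 (Sum.inl e, false))
          (p.2 (Sum.inl e, false)) (f (Sum.inl e)) (Γ₀.len e)) ∧
      ∀ v, copyData v p - Γ₁.partData lam C S (fun e => f (Sum.inr (v, e))) ∈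
        Γ₁.homData lam C S := by
  have key : ∀ v e, (p.1 (Sum.inr (v, e), true) = sol C S (p.1 (Sum.inr (v, e), false))
      (p.2 (Sum.inr (v, e), false)) (f (Sum.inr (v, e))) (Γ₁.len e) ∧
      p.2 (Sum.inr (v, e), true) = -solDeriv lam C S (p.1 (Sum.inr (v, e), false))
      (p.2 (Sum.inr (v, e), false)) (f (Sum.inr (v, e))) (Γ₁.len e)) ↔
      ((copyData v p - Γ₁.partData lam C S (fun e => f (Sum.inr (v, e)))).1 (e, true) =
        (copyData v p - Γ₁.partData lam C S (fun e => f (Sum.inr (v, e)))).1 (e, false) *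
          C (Γ₁.len e) +
        (copyData v p - Γ₁.partData lam C S (fun e => f (Sum.inr (v, e)))).2 (e, false) *
          S (Γ₁.len e) ∧
      (copyData v p - Γ₁.partData lam C S (fun e => f (Sum.inr (v, e)))).2 (e, true) =
        -(-lam * (copyData v p - Γ₁.partData lam C S (fun e => f (Sum.inr (v, e)))).1 (e, false) *
          S (Γ₁.len e) +
        (copyData v p - Γ₁.partData lam C S (fun e => f (Sum.inr (v, e)))).2 (e, false) *
          C (Γ₁.len e))) := by
    intro v e
    rw [sol_eq_add, solDeriv_eq_add]
    simp only [Prod.fst_sub, Prod.snd_sub, Pi.sub_apply, copyData, partData, if_true,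
      Bool.false_eq_true, if_false, sub_zero, sub_eq_iff_eq_add]
    refine and_congr Iff.rfl ?_
    rw [neg_add]
  constructor
  · intro h
    exact ⟨fun e => h (Sum.inl e), fun v e => (key v e).1 (h (Sum.inr (v, e)))⟩
  · rintro ⟨h1, h2⟩ (e | ⟨v, e⟩)
    · exact h1 e
    · exact (key v e).2 (h2 v e)

/-- The homogeneous equation on the decorated graph has only the zero solution. -/
theorem data_eq_zero_of_decorated [Fintype V₁] [Fintype E₁] (h : IsFundamental lam C S)
    (hS : ∀ e, S (Γ₀.len e) ≠ 0)
    {L : ∀ a, Γ₁.VertexCondition a} (hL : ∀ a, a ≠ v₁ → (L a).IsSelfAdjoint)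
    (hsimple : UnboundedOp.IsSimpleEigenvalue
      (Γ₁.hamiltonian (Γ₁.decorationConditions v₁ L)) (lam : ℂ))
    {ψ ψ'' : Γ₁.L2} {F F' : E₁ × Bool → ℂ}
    (hψ : ψ ∈ UnboundedOp.eigenspace (Γ₁.hamiltonian (Γ₁.decorationConditions v₁ L)) (lam : ℂ))
    (hF : Γ₁.IsH2 ψ ψ'' F F') (hne : ∑ d : Γ₁.Ends v₁, F' d ≠ 0)
    {p : ((E₀ ⊕ V₀ × E₁) × Bool → ℂ) × ((E₀ ⊕ V₀ × E₁) × Bool → ℂ)}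
    (hp : p ∈ (Γ₀.decorate Γ₁ v₁).homData lam C S)
    (hpL : p ∈ (Γ₀.decorate Γ₁ v₁).condData (Γ₀.decoratedConditions Γ₁ v₁ L)) :
    ∀ e, p.1 (e, false) = 0 ∧ p.2 (e, false) = 0 := by
  obtain ⟨h1, h2⟩ := mem_condData_decorated_iff.1 hpL
  have hψ0 : ∀ d : Γ₁.Ends v₁, F d = 0 := by
    have := (data_of_mem_eigenspace h hψ hF).2 v₁
    rw [decorationConditions, if_pos rfl] at this
    exact fun d => congrFun this d
  obtain ⟨d₁⟩ : Nonempty (Γ₁.Ends v₁) := by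
    by_contra hE
    rw [not_nonempty_iff] at hE
    exact hne (by simp)
  have hcopy : ∀ v, ∃ t : ℂ, copyData v p = t • (F, F') := fun v => by
    obtain ⟨⟨c, -, hc⟩, -⟩ := h2 v
    exact exists_eq_smul_of_continuous_at_root h hL hsimple hψ hF hne
      (copyData_mem_homData hp v) (h1 v) hc
  have hval : ∀ v (d : Γ₀.Ends v), p.1 (Sum.inl d.1.1, d.1.2) = 0 := by
    intro v d
    obtain ⟨⟨c, hc0, hc1⟩, -⟩ := h2 v
    obtain ⟨t, ht⟩ := hcopy v
    rw [hc0, ← hc1 d₁, ht]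
    simp [hψ0]
  -- The values at both ends are zero, and S does not vanish at the length, so the edge carries no
  -- solution.
  have hbase : ∀ e, p.2 (Sum.inl e, false) = 0 ∧ p.2 (Sum.inl e, true) = 0 := by
    intro e
    obtain ⟨k1, k2⟩ := hp (Sum.inl e)
    have v0 := hval _ ⟨(e, false), rfl⟩
    have v1 := hval _ ⟨(e, true), rfl⟩
    simp only at v0 v1
    have hS' : (S ((Γ₀.decorate Γ₁ v₁).len (Sum.inl e)) : ℂ) ≠ 0 := by
      exact_mod_cast hS e
    rw [v0, v1, zero_mul, zero_add] at k1
    have k3 := (mul_eq_zero.1 k1.symm).resolve_right hS'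
    refine ⟨k3, ?_⟩
    rw [k2, v0, k3]
    simp
  rintro (e | ⟨v, e⟩)
  · exact ⟨hval _ ⟨(e, false), rfl⟩, (hbase e).1⟩
  · obtain ⟨t, ht⟩ := hcopy v
    obtain ⟨-, hs⟩ := h2 v
    have hz : ∀ d : Γ₀.Ends v, p.2 (Sum.inl d.1.1, d.1.2) = 0 := by
      rintro ⟨⟨e, b⟩, -⟩
      cases b
      · exact (hbase e).1
      · exact (hbase e).2
    -- No flux comes from the base, so the Neumann condition at v reads t · flux(ψ) = 0.
    rw [ht] at hs
    simp only [hz, Finset.sum_const_zero, zero_add, Prod.smul_snd, Pi.smul_apply, smul_eq_mul,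
      ← Finset.mul_sum] at hs
    have ht0 := (mul_eq_zero.1 hs).resolve_right hne
    rw [ht0, zero_smul] at ht
    exact ⟨congrFun (congrArg Prod.fst ht) (e, false), congrFun (congrArg Prod.snd ht) (e, false)⟩

end MetricGraph

/-! ### Solving the inhomogeneous equation on the decorated graph -/

namespace MetricGraph

open SturmLiouville

variable {V₀ E₀ V₁ E₁ : Type*} {Γ₀ : MetricGraph V₀ E₀} {Γ₁ : MetricGraph V₁ E₁} {v₁ : V₁}
  {lam : ℝ} {C S : ℝ → ℝ}

theorem enorm_sq_decorate [Fintype E₁] (f : (Γ₀.decorate Γ₁ v₁).L2) :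
    ‖f‖ₑ ^ 2 = ∑' e, ‖f (Sum.inl e)‖ₑ ^ 2 + ∑' v, ∑ e, ‖f (Sum.inr (v, e))‖ₑ ^ 2 := by
  rw [lp.enorm_sq_eq_tsum, Summable.tsum_sum ENNReal.summable ENNReal.summable,
    ENNReal.tsum_prod']
  simp only [tsum_fintype]

/-- The inhomogeneous equation on the decorated graph has a solution with square summable boundary
data. -/
theorem exists_data_decorated [Fintype V₁] [Fintype E₁] (h : IsFundamental lam C S) {m M : ℝ}
    (hm : ∀ e, Γ₀.len e ≤ m) (hM : ∀ e, |(S (Γ₀.len e))⁻¹| ≤ M) (hS : ∀ e, S (Γ₀.len e) ≠ 0)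
    {D : ℕ} (hD : ∀ v, Γ₀.degree v ≤ D)
    {L : ∀ a, Γ₁.VertexCondition a} (hL : ∀ a, a ≠ v₁ → (L a).IsSelfAdjoint)
    (hsimple : UnboundedOp.IsSimpleEigenvalue
      (Γ₁.hamiltonian (Γ₁.decorationConditions v₁ L)) (lam : ℂ))
    {ψ ψ'' : Γ₁.L2} {F F' : E₁ × Bool → ℂ}
    (hψ : ψ ∈ UnboundedOp.eigenspace (Γ₁.hamiltonian (Γ₁.decorationConditions v₁ L)) (lam : ℂ))
    (hF : Γ₁.IsH2 ψ ψ'' F F') (hne : ∑ d : Γ₁.Ends v₁, F' d ≠ 0) :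
    ∃ K : NNReal, ∀ f : (Γ₀.decorate Γ₁ v₁).L2,
      ∃ p : ((E₀ ⊕ V₀ × E₁) × Bool → ℂ) × ((E₀ ⊕ V₀ × E₁) × Bool → ℂ),
        (Γ₀.decorate Γ₁ v₁).IsSolutionData lam C S f p.1 p.2 ∧
        p ∈ (Γ₀.decorate Γ₁ v₁).condData (Γ₀.decoratedConditions Γ₁ v₁ L) ∧
        ∑' e, (‖p.1 (e, false)‖ₑ ^ 2 + ‖p.2 (e, false)‖ₑ ^ 2) ≤ K * ‖f‖ₑ ^ 2 := by
  obtain ⟨hψh, hψc⟩ := data_of_mem_eigenspace h hψ hF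
  have hψL : ∀ a, a ≠ v₁ → ((fun d : Γ₁.Ends a => F d), (fun d : Γ₁.Ends a => F' d)) ∈ L a := by
    intro a ha
    have := hψc a
    rwa [decorationConditions, if_neg ha] at this
  have hψ0 : ∀ d : Γ₁.Ends v₁, F d = 0 := by
    have := hψc v₁
    rw [decorationConditions, if_pos rfl] at this
    exact fun d => congrFun this d
  obtain ⟨d₁⟩ : Nonempty (Γ₁.Ends v₁) := by
    by_contra hE
    rw [not_nonempty_iff] at hE
    exact hne (by simp)
  obtain ⟨Q, hQ⟩ := exists_projection_neumannConditions h hL hsimple hψ hF hne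
  obtain ⟨KB, hKB⟩ := exists_bound_partData (Γ := Γ₁) h Q
  obtain ⟨KD, hKD⟩ := exists_bound_dirichletDeriv h m M
  set flux := ∑ d : Γ₁.Ends v₁, F' d with hflux
  set w : NNReal := ‖flux⁻¹‖₊ * ‖(F, F')‖₊ with hw
  set T : NNReal := D * KB + D * KB + 1 with hT
  -- The first bracket bounds the base data: vertex values, then initial derivatives. T collects the
  -- values at the two ends and the source. On the copies, 4 = 2 · 2 comes from two kinds of data,
  -- each a sum of two terms squared, and w bounds the correction by ψ.
  refine ⟨(D * KB + KD * T) + 4 * Fintype.card E₁ * (KB + w ^ 2 * (D * (2 * KD * T))),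
    fun f => ?_⟩
  set fb : ∀ e, Lp ℂ 2 (Γ₀.edgeMeasure e) := fun e => f (Sum.inl e) with hfb
  set fc : ∀ (_ : V₀) e, Lp ℂ 2 (Γ₁.edgeMeasure e) := fun v e => f (Sum.inr (v, e)) with hfc
  have hN : ‖f‖ₑ ^ 2 = ∑' e, ‖fb e‖ₑ ^ 2 + ∑' v, ∑ e, ‖fc v e‖ₑ ^ 2 := enorm_sq_decorate f
  set N := ‖f‖ₑ ^ 2
  -- Solution data on the copy at v, continuous with zero flux at the root.
  set B : V₀ → (E₁ × Bool → ℂ) × (E₁ × Bool → ℂ) :=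
    fun v => Q (Γ₁.partData lam C S fun e => fc v e) with hBdef
  have hBL : ∀ v a, a ≠ v₁ →
      ((fun d : Γ₁.Ends a => (B v).1 d), (fun d : Γ₁.Ends a => (B v).2 d)) ∈ L a := by
    intro v a ha
    have := (hQ (Γ₁.partData lam C S fun e => fc v e)).1 a
    rwa [neumannConditions, if_neg ha] at this
  have hBN : ∀ v, ((fun d : Γ₁.Ends v₁ => (B v).1 d), (fun d : Γ₁.Ends v₁ => (B v).2 d)) ∈
      Γ₁.neumann v₁ := by
    intro v
    have := (hQ (Γ₁.partData lam C S fun e => fc v e)).1 v₁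
    rwa [neumannConditions, if_pos rfl] at this
  -- The value at v is dictated by the copy alone, since multiples of ψ vanish at the root.
  set c : V₀ → ℂ := fun v => (B v).1 d₁ with hc
  set β : E₀ → ℂ := fun e => dirichletDeriv C S (Γ₀.len e) (c (Γ₀.endpt (e, false)))
    (c (Γ₀.endpt (e, true))) (fb e) with hβ
  set G : E₀ × Bool → ℂ := fun d => if d.2 then
    -solDeriv lam C S (c (Γ₀.endpt (d.1, false))) (β d.1) (fb d.1) (Γ₀.len d.1) else β d.1 with hG
  -- The flux that the copy must supply to balance the base edges; the multiple s v / flux of ψ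
  -- supplies it.
  set s : V₀ → ℂ := fun v => -∑ d : Γ₀.Ends v, G d with hs
  set p : ((E₀ ⊕ V₀ × E₁) × Bool → ℂ) × ((E₀ ⊕ V₀ × E₁) × Bool → ℂ) :=
    (fun d => Sum.elim (fun e => c (Γ₀.endpt (e, d.2)))
      (fun q => (B q.1).1 (q.2, d.2) + s q.1 * flux⁻¹ * F (q.2, d.2)) d.1,
    fun d => Sum.elim (fun e => G (e, d.2))
      (fun q => (B q.1).2 (q.2, d.2) + s q.1 * flux⁻¹ * F' (q.2, d.2)) d.1) with hp
  have hcopy : ∀ v, copyData v p = B v + (s v * flux⁻¹) • (F, F') := fun v => rfl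
  refine ⟨p, isSolutionData_decorate_iff.2 ⟨fun e => ⟨?_, rfl⟩, fun v => ?_⟩,
    mem_condData_decorated_iff.2 ⟨fun v a ha => ?_, fun v => ⟨⟨c v, fun d => ?_, fun d => ?_⟩, ?_⟩⟩,
    ?_⟩
  · exact (sol_dirichletDeriv (hS e) _ _ _).symm
  · rw [hcopy, add_sub_right_comm]
    exact Submodule.add_mem _ (hQ _).2 (Submodule.smul_mem _ _ hψh)
  · rw [hcopy]
    exact (L a).add_mem (hBL v a ha) ((L a).smul_mem (s v * flux⁻¹) (hψL a ha))
  · change c (Γ₀.endpt d.1) = c v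
    rw [d.2]
  · rw [hcopy]
    have h1 := (hBN v).1 d d₁
    simp only at h1
    simp [hψ0, h1, hc]
  · rw [hcopy]
    have h1 := (hBN v).2
    simp only at h1
    simp only [Prod.snd_add, Prod.smul_snd, Pi.add_apply, Pi.smul_apply, smul_eq_mul,
      Finset.sum_add_distrib, h1, ← Finset.mul_sum, zero_add]
    rw [← hflux, mul_assoc, inv_mul_cancel₀ hne, mul_one, hs]
    exact add_neg_cancel _
  -- Square sums are estimated in the order of the construction: B, the values c, the derivatives β
  -- and G, the fluxes s. Passing between vertices and edge ends costs a factor D each time.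
  · have bB : ∑' v, ‖B v‖ₑ ^ 2 ≤ KB * N := by
      calc ∑' v, ‖B v‖ₑ ^ 2 ≤ ∑' v, KB * ∑ e, ‖fc v e‖ₑ ^ 2 :=
            ENNReal.tsum_le_tsum fun v => hKB (fc v)
        _ = KB * ∑' v, ∑ e, ‖fc v e‖ₑ ^ 2 := ENNReal.tsum_mul_left
        _ ≤ KB * N := by
            rw [hN]
            gcongr
            exact le_add_self
    have nB1 : ∀ v d, ‖(B v).1 d‖ₑ ≤ ‖B v‖ₑ := fun v d => by
      rw [enorm_le_iff_norm_le]
      exact (norm_le_pi_norm _ d).trans (norm_fst_le _)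
    have nB2 : ∀ v d, ‖(B v).2 d‖ₑ ≤ ‖B v‖ₑ := fun v d => by
      rw [enorm_le_iff_norm_le]
      exact (norm_le_pi_norm _ d).trans (norm_snd_le _)
    have bc : ∑' v, ‖c v‖ₑ ^ 2 ≤ KB * N :=
      (ENNReal.tsum_le_tsum fun v => by gcongr; exact nB1 v d₁).trans bB
    have bce : ∀ b, ∑' e, ‖c (Γ₀.endpt (e, b))‖ₑ ^ 2 ≤ D * KB * N := fun b => by
      rw [mul_assoc]
      exact (tsum_edge_endpt_le hD (fun v => ‖c v‖ₑ ^ 2) b).trans (by gcongr)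
    have bT : ∑' e, (‖c (Γ₀.endpt (e, false))‖ₑ ^ 2 + ‖c (Γ₀.endpt (e, true))‖ₑ ^ 2 +
        ‖fb e‖ₑ ^ 2) ≤ T * N := by
      rw [ENNReal.tsum_add, ENNReal.tsum_add, hT]
      push_cast
      rw [add_mul, add_mul, one_mul]
      gcongr
      · exact bce false
      · exact bce true
      · rw [hN]
        exact le_self_add
    have hKD' := fun e => hKD (Γ₀.len e) (Γ₀.len_pos e) (hm e) (hM e) (fb e)
      (c (Γ₀.endpt (e, false))) (c (Γ₀.endpt (e, true)))
    have bβ : ∑' e, ‖β e‖ₑ ^ 2 ≤ KD * T * N := by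
      rw [mul_assoc]
      refine (ENNReal.tsum_le_tsum fun e => (hKD' e).1).trans ?_
      rw [ENNReal.tsum_mul_left]
      gcongr
    have bβ' : ∑' e, ‖G (e, true)‖ₑ ^ 2 ≤ KD * T * N := by
      rw [mul_assoc]
      refine le_trans (ENNReal.tsum_le_tsum fun e => ?_) (b := ∑' e, KD *
        (‖c (Γ₀.endpt (e, false))‖ₑ ^ 2 + ‖c (Γ₀.endpt (e, true))‖ₑ ^ 2 + ‖fb e‖ₑ ^ 2)) ?_
      · simp only [hG, if_true, enorm_neg]
        exact (hKD' e).2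
      · rw [ENNReal.tsum_mul_left]
        gcongr
    have bs : ∑' v, ‖s v‖ₑ ^ 2 ≤ D * (2 * KD * T) * N := by
      simp only [hs, enorm_neg]
      refine (tsum_flux_le hD G).trans ?_
      rw [mul_assoc]
      gcongr
      rw [ENNReal.tsum_prod']
      simp only [tsum_fintype, Fintype.sum_bool]
      rw [ENNReal.tsum_add]
      refine (add_le_add bβ' bβ).trans (le_of_eq ?_)
      ring
    have nF1 : ∀ d, ‖F d‖ₑ ≤ ‖(F, F')‖ₑ := fun d => by
      rw [enorm_le_iff_norm_le]
      exact (norm_le_pi_norm F d).trans (norm_fst_le (F, F'))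
    have nF2 : ∀ d, ‖F' d‖ₑ ≤ ‖(F, F')‖ₑ := fun d => by
      rw [enorm_le_iff_norm_le]
      exact (norm_le_pi_norm F' d).trans (norm_snd_le (F, F'))
    have hterm : ∀ v (x y : ℂ), ‖x‖ₑ ≤ ‖B v‖ₑ → ‖y‖ₑ ≤ ‖(F, F')‖ₑ →
        ‖x + s v * flux⁻¹ * y‖ₑ ^ 2 ≤ 2 * (‖B v‖ₑ ^ 2 + w ^ 2 * ‖s v‖ₑ ^ 2) := by
      intro v x y hx hy
      have h1 : ‖s v * flux⁻¹ * y‖ₑ ≤ w * ‖s v‖ₑ := by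
        rw [enorm_mul, enorm_mul, hw, ENNReal.coe_mul]
        calc ‖s v‖ₑ * ‖flux⁻¹‖ₑ * ‖y‖ₑ ≤ ‖s v‖ₑ * ‖flux⁻¹‖ₑ * ‖(F, F')‖ₑ := by gcongr
          _ = ‖flux⁻¹‖ₑ * ‖(F, F')‖ₑ * ‖s v‖ₑ := by ring
      calc ‖x + s v * flux⁻¹ * y‖ₑ ^ 2 ≤ (‖B v‖ₑ + w * ‖s v‖ₑ) ^ 2 := by
            gcongr
            exact (enorm_add_le _ _).trans (add_le_add hx h1)
        _ ≤ _ := by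
            rw [← mul_pow]
            exact ENNReal.add_sq_le _ _
    rw [Summable.tsum_sum ENNReal.summable ENNReal.summable, ENNReal.tsum_prod']
    push_cast
    rw [add_mul]
    refine add_le_add ?_ ?_
    · rw [ENNReal.tsum_add, add_mul]
      exact add_le_add (bce false) bβ
    · calc _ ≤ ∑' v, 4 * (Fintype.card E₁ : ENNReal) * (‖B v‖ₑ ^ 2 + w ^ 2 * ‖s v‖ₑ ^ 2) := by
            refine ENNReal.tsum_le_tsum fun v => ?_
            rw [tsum_fintype]
            refine (Finset.sum_le_card_nsmul _ _ (4 * (‖B v‖ₑ ^ 2 + w ^ 2 * ‖s v‖ₑ ^ 2))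
              fun e _ => ?_).trans (le_of_eq ?_)
            · refine (add_le_add (hterm v _ _ (nB1 v (e, false)) (nF1 (e, false)))
                (hterm v _ _ (nB2 v (e, false)) (nF2 (e, false)))).trans (le_of_eq ?_)
              ring
            · rw [nsmul_eq_mul, Finset.card_univ]
              ring
        _ = 4 * (Fintype.card E₁ : ENNReal) * (∑' v, ‖B v‖ₑ ^ 2 + w ^ 2 * ∑' v, ‖s v‖ₑ ^ 2) := by
            rw [ENNReal.tsum_mul_left, ENNReal.tsum_add, ENNReal.tsum_mul_left]
        _ ≤ 4 * (Fintype.card E₁ : ENNReal) * (KB * N + w ^ 2 * (D * (2 * KD * T) * N)) := by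
            gcongr
        _ = _ := by ring

/-- A simple Dirichlet eigenvalue of the decoration with nonzero flux, away from the Dirichlet
spectrum of the base graph, belongs to the resolvent set of the decorated graph. -/
theorem mem_resolventSet_decorated [Finite V₁] [Finite E₁] (hA : Γ₀.ConditionA)
    (hlam : lam ∉ Γ₀.dirichletSpectrum) {D : ℕ} (hD : ∀ v, Γ₀.degree v ≤ D)
    {L : ∀ a, Γ₁.VertexCondition a} (hL : ∀ a, a ≠ v₁ → (L a).IsSelfAdjoint)
    (hsimple : UnboundedOp.IsSimpleEigenvalue
      (Γ₁.hamiltonian (Γ₁.decorationConditions v₁ L)) (lam : ℂ))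
    {ψ ψ'' : Γ₁.L2} {F F' : E₁ × Bool → ℂ}
    (hψ : ψ ∈ UnboundedOp.eigenspace (Γ₁.hamiltonian (Γ₁.decorationConditions v₁ L)) (lam : ℂ))
    (hF : Γ₁.IsH2 ψ ψ'' F F') (hne : ∑ d : Γ₁.Ends v₁, F' d ≠ 0) :
    (lam : ℂ) ∈ UnboundedOp.resolventSet
      ((Γ₀.decorate Γ₁ v₁).hamiltonian (Γ₀.decoratedConditions Γ₁ v₁ L)) := by
  cases nonempty_fintype V₁
  cases nonempty_fintype E₁
  obtain ⟨C, S, h, hCS⟩ := exists_isFundamental lam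
  obtain ⟨M, hM⟩ := exists_bound_inv hA hlam h hCS
  have hS : ∀ e, S (Γ₀.len e) ≠ 0 := by
    intro e h0
    obtain ⟨n, hn, he⟩ := hCS _ (Γ₀.len_pos e) h0
    exact hlam (subset_closure ⟨e, n, hn, he⟩)
  obtain ⟨l₀, m, -, hm⟩ := hA
  obtain ⟨K, hK⟩ := exists_data_decorated (v₁ := v₁) h (fun e => (hm e).2) hM hS hD hL hsimple
    hψ hF hne
  have hlen : ∀ e, (Γ₀.decorate Γ₁ v₁).len e ≤ max m (∑ e, Γ₁.len e) := by
    rintro (e | ⟨v, e⟩)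
    · exact (hm e).2.trans (le_max_left _ _)
    · exact (Finset.single_le_sum (f := Γ₁.len) (fun e _ => (Γ₁.len_pos e).le)
        (Finset.mem_univ e)).trans (le_max_right _ _)
  obtain ⟨K', hK'⟩ := exists_isH2_of_isSolutionData h hlen
  -- ‖u‖² is at most K' times the square sum of the data plus ‖f‖², and that square sum is at most
  -- K‖f‖².
  refine UnboundedOp.mem_resolventSet_of_bijective (√(K' * (K + 1) : NNReal)) ?_ ?_
  · rintro ⟨u, hu⟩ he
    obtain ⟨G, G', hG, hGL⟩ := mem_eigenspace_hamiltonian.1 (⟨hu, he⟩ : u ∈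
      UnboundedOp.eigenspace ((Γ₀.decorate Γ₁ v₁).hamiltonian
        (Γ₀.decoratedConditions Γ₁ v₁ L)) (lam : ℂ))
    have hG0 : (Γ₀.decorate Γ₁ v₁).IsH2 u (-(0 + (lam : ℂ) • u)) G G' := by rwa [zero_add]
    have hz := data_eq_zero_of_decorated (p := (G, G')) h hS hL hsimple hψ hF hne
      (isSolutionData_zero_iff.1 (hG0.eq_sol h).1) hGL
    exact hG0.eq_zero_of_data h (fun e => (hz e).1) fun e => (hz e).2
  · intro f
    obtain ⟨p, hp, hpL, hb⟩ := hK f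
    have hfin : (K : ENNReal) * ‖f‖ₑ ^ 2 ≠ ⊤ :=
      ENNReal.mul_ne_top ENNReal.coe_ne_top (ENNReal.pow_ne_top enorm_ne_top)
    obtain ⟨u, hu, hub⟩ := hK' f p.1 p.2 hp (ne_top_of_le_ne_top hfin hb)
    obtain ⟨hdom, hval⟩ := (mem_hamiltonianGraph_iff (Γ₀.decoratedConditions Γ₁ v₁ L) u
      (f + (lam : ℂ) • u)).1 ⟨p.1, p.2, hu, hpL⟩
    refine ⟨⟨u, hdom⟩, by rw [hval, add_sub_cancel_right], ?_⟩
    have h1 : ‖u‖ₑ ^ 2 ≤ ((K' * (K + 1) : NNReal) : ENNReal) * ‖f‖ₑ ^ 2 := by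
      refine hub.trans ?_
      push_cast
      rw [mul_assoc, add_mul, one_mul]
      gcongr
    have h2 : ‖u‖₊ ^ 2 ≤ K' * (K + 1) * ‖f‖₊ ^ 2 := by
      rw [← ENNReal.coe_le_coe]
      push_cast at h1 ⊢
      exact h1
    have h3 : ‖u‖ ^ 2 ≤ ((K' * (K + 1) : NNReal) : ℝ) * ‖f‖ ^ 2 := by exact_mod_cast h2
    refine (pow_le_pow_iff_left₀ (norm_nonneg u) (by positivity) two_ne_zero).1 ?_
    rwa [mul_pow, Real.sq_sqrt (NNReal.coe_nonneg _)]

end MetricGraph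
end

/-- The center of the punctured neighborhood is itself a resolvent point, so openness of the
resolvent set finishes the proof. -/
theorem theorem4p1 {V₀ E₀ V₁ E₁ : Type*}
    (Γ₀ : MetricGraph V₀ E₀) (hconn₀ : Γ₀.IsConnected) (hA : Γ₀.ConditionA)
    (hdeg : ∃ D : ℕ, ∀ v, Γ₀.degree v ≤ D)
    [Finite V₁] [Finite E₁] (Γ₁ : MetricGraph V₁ E₁) (hconn₁ : Γ₁.IsConnected) (v₁ : V₁)
    (L : ∀ a, Γ₁.VertexCondition a) (hL : ∀ a, a ≠ v₁ → (L a).IsSelfAdjoint)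
    (lam₀ : ℝ) (hlam₀ : lam₀ ∉ Γ₀.dirichletSpectrum)
    (hsimple : UnboundedOp.IsSimpleEigenvalue
      (Γ₁.hamiltonian (Γ₁.decorationConditions v₁ L)) (lam₀ : ℂ))
    (ψ ψ'' : Γ₁.L2) (F F' : E₁ × Bool → ℂ)
    (hψ : ψ ∈ UnboundedOp.eigenspace
      (Γ₁.hamiltonian (Γ₁.decorationConditions v₁ L)) (lam₀ : ℂ))
    (hF : Γ₁.IsH2 ψ ψ'' F F')
    (hne : ∑ d : Γ₁.Ends v₁, F' d ≠ 0) :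
    ∀ᶠ z : ℂ in 𝓝[≠] (lam₀ : ℂ), z ∉ UnboundedOp.spectrum
      ((Γ₀.decorate Γ₁ v₁).hamiltonian (Γ₀.decoratedConditions Γ₁ v₁ L)) := by
  obtain ⟨D, hD⟩ := hdeg
  have h := MetricGraph.mem_resolventSet_decorated hA hlam₀ hD hL hsimple hψ hF hne
  have ho := (UnboundedOp.isOpen_resolventSet _).mem_nhds h
  filter_upwards [mem_nhdsWithin_of_mem_nhds ho] with z hz
  exact not_not.2 hz
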